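/- All graphs are finite and simple, and membership in a family of graphs is up to isomorphism. Let $P_n$ denote the path of order $n$. A graph $G$ is *hypomatchable* if $G-x$ has a perfect matching for every $x\in V(G)$. A *$\{P_2,P_9\}$-factor* of $G$ is a spanning subgraph of $G$ each of whose components is isomorphic to $P_2$ or $P_9$. For nonnegative integers $s_1,s_2,s_3$, let $Q=u_1u_2u_3$ be a path of order $3$ and, for $i\in\{1,2,3\}$ and $1\le j\le s_i$, let $L_{i,j}$ be a path of order $2$, all these paths being pairwise disjoint; write $L_{2,j}=v_{1,j}v_{3,j}$. Let $B=Q\cup\bigcup_{i,j}L_{i,j}$. Define the following graphs. * $A_1(s_1,s_2,s_3)$ is obtained from $B$ by adding the edge $u_1u_3$ and joining $u_i$ to all vertices in $\bigcup_{1\le j\le s_i}V(L_{i,j})$ for each $i\in\{1,2,3\}$. * $A_2'(s_1,s_2,s_3)$ is obtained from $B$ by joining $u_i$ to all vertices in $\bigcup_{1\le j\le s_i}V(L_{i,j})\cup\{v_{i,j}\mid 1\le j\le s_2\}$ for each $i\in\{1,3\}$. * $A_2''(s_1,s_2,s_3)$ is obtained from $B$ by adding the edge $u_1u_3$ and joining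 $u_i$ to all vertices in $\bigcup_{1\le j\le s_i}V(L_{i,j})\cup\bigcup_{1\le j\le s_2}V(L_{2,j})$ for each $i\in\{1,3\}$. * $A_3'(s_1)=A_2'(s_1,1,0)$, and $A_3''(s_1)$ is obtained from $A_3'(s_1)$ by joining all pairs of distinct vertices in $V(Q)\cup V(L_{2,1})$. * $A_4'(s_1)$ is obtained from $A_2'(s_1,2,0)$ by adding the edge $v_{3,1}v_{3,2}$, and $A_4''(s_1)$ is obtained from $A_4'(s_1)$ by adding the edges $u_1u_3$, $u_1v_{3,1}$, $u_1v_{3,2}$. Define the families $$\mathcal G_1=\{A_1(s_1,s_2,s_3)\mid s_1+s_2+s_3\ge 3\},$$ $$\mathcal G_2=\{H\mid A_2'(s_1,s_2,s_3)\subseteq H\subseteq A_2''(s_1,s_2,s_3),\ s_2\ge 1,\ s_1+s_2+s_3\ge 3,\ \text{and either } (s_1\ge 1 \text{ and } s_3\ge 1) \text{ or } s_2\ge 2\},$$ $$\mathcal G_3=\{H\mid A_3'(s_1)\subseteq H\subseteq A_3''(s_1),\ s_1\ge 2\},\qquad \mathcal G_4=\{H\mid A_4'(s_1)\subseteq H\subseteq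 A_4''(s_1),\ s_1\ge 1\}.$$ **Proposition.** Let $G$ be a hypomatchable graph of order at least $9$ having no $\{P_2,P_9\}$-factor. Then $G\in\mathcal G_1\cup\mathcal G_2\cup\mathcal G_3\cup\mathcal G_4$. -/

import Mathlib

/-- A graph `G` is hypomatchable if `G - x` has a perfect matching for every vertex `x`. -/
def Hypomatchable {V : Type*} (G : SimpleGraph V) : Prop :=
  ∀ x : V, ∃ M : (G.induce ({x}ᶜ : Set V)).Subgraph, M.IsPerfectMatching

/-- `G` has a `{P_n | n ∈ S}`-factor: a spanning subgraph `F` of `G` each of whose components is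
isomorphic to the path of order `n` for some `n ∈ S`. -/
def HasPathFactor {V : Type*} (S : Set ℕ) (G : SimpleGraph V) : Prop :=
  ∃ F : SimpleGraph V, F ≤ G ∧
    ∀ C : F.ConnectedComponent, ∃ n ∈ S, Nonempty (C.toSimpleGraph ≃g SimpleGraph.pathGraph n)

namespace HypoFamilies

/-- The vertices of `Q ∪ ⋃ L_{i,j}`: the vertices `u₁, u₂, u₃` of the path `Q`, the two vertices
`x₁ j false`, `x₁ j true` of `L_{1,j}` for `j < s₁`, the two vertices `v₁ j`, `v₃ j` of `L_{2,j}` for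
`j < s₂`, and the two vertices `x₃ j false`, `x₃ j true` of `L_{3,j}` for `j < s₃`. -/
inductive Vertex (s₁ s₂ s₃ : ℕ) : Type
  | u₁ : Vertex s₁ s₂ s₃
  | u₂ : Vertex s₁ s₂ s₃
  | u₃ : Vertex s₁ s₂ s₃
  | x₁ (j : Fin s₁) (e : Bool) : Vertex s₁ s₂ s₃
  | v₁ (j : Fin s₂) : Vertex s₁ s₂ s₃
  | v₃ (j : Fin s₂) : Vertex s₁ s₂ s₃
  | x₃ (j : Fin s₃) (e : Bool) : Vertex s₁ s₂ s₃

open Vertex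

/-- The union of the vertex sets of the paths `L_{1,j}`. -/
def L₁ (s₁ s₂ s₃ : ℕ) : Set (Vertex s₁ s₂ s₃) := {w | ∃ j e, w = x₁ j e}

/-- The union of the vertex sets of the paths `L_{2,j}`. -/
def L₂ (s₁ s₂ s₃ : ℕ) : Set (Vertex s₁ s₂ s₃) := {w | ∃ j, w = v₁ j ∨ w = v₃ j}

/-- The union of the vertex sets of the paths `L_{3,j}`. -/
def L₃ (s₁ s₂ s₃ : ℕ) : Set (Vertex s₁ s₂ s₃) := {w | ∃ j e, w = x₃ j e}

/-- The edges of `Q ∪ ⋃ L_{i,j}`, each listed in one direction. -/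
inductive BaseEdge (s₁ s₂ s₃ : ℕ) : Vertex s₁ s₂ s₃ → Vertex s₁ s₂ s₃ → Prop
  | q₁₂ : BaseEdge s₁ s₂ s₃ u₁ u₂
  | q₂₃ : BaseEdge s₁ s₂ s₃ u₂ u₃
  | l₁ (j : Fin s₁) : BaseEdge s₁ s₂ s₃ (x₁ j false) (x₁ j true)
  | l₂ (j : Fin s₂) : BaseEdge s₁ s₂ s₃ (v₁ j) (v₃ j)
  | l₃ (j : Fin s₃) : BaseEdge s₁ s₂ s₃ (x₃ j false) (x₃ j true)

/-- The disjoint union of the path `Q = u₁u₂u₃` and the `s₁ + s₂ + s₃` paths `L_{i,j}`. -/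
def base (s₁ s₂ s₃ : ℕ) : SimpleGraph (Vertex s₁ s₂ s₃) :=
  SimpleGraph.fromRel (BaseEdge s₁ s₂ s₃)

/-- The graph whose edges join the vertex `u` to all vertices of `S` (other than `u`). -/
def joinTo {V : Type*} (u : V) (S : Set V) : SimpleGraph V :=
  SimpleGraph.fromRel fun a b => a = u ∧ b ∈ S

/-- The graph whose edges join all pairs of distinct vertices of `S`. -/
def completeOn {V : Type*} (S : Set V) : SimpleGraph V :=
  SimpleGraph.fromRel fun a b => a ∈ S ∧ b ∈ S

/-- The graph `A₁(s₁, s₂, s₃)`. -/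
def A₁ (s₁ s₂ s₃ : ℕ) : SimpleGraph (Vertex s₁ s₂ s₃) :=
  base s₁ s₂ s₃ ⊔ SimpleGraph.edge u₁ u₃
    ⊔ joinTo u₁ (L₁ s₁ s₂ s₃) ⊔ joinTo u₂ (L₂ s₁ s₂ s₃) ⊔ joinTo u₃ (L₃ s₁ s₂ s₃)

/-- The graph `A₂'(s₁, s₂, s₃)`. -/
def A₂min (s₁ s₂ s₃ : ℕ) : SimpleGraph (Vertex s₁ s₂ s₃) :=
  base s₁ s₂ s₃
    ⊔ joinTo u₁ (L₁ s₁ s₂ s₃ ∪ Set.range v₁) ⊔ joinTo u₃ (L₃ s₁ s₂ s₃ ∪ Set.range v₃)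

/-- The graph `A₂''(s₁, s₂, s₃)`. -/
def A₂max (s₁ s₂ s₃ : ℕ) : SimpleGraph (Vertex s₁ s₂ s₃) :=
  base s₁ s₂ s₃ ⊔ SimpleGraph.edge u₁ u₃
    ⊔ joinTo u₁ (L₁ s₁ s₂ s₃ ∪ L₂ s₁ s₂ s₃) ⊔ joinTo u₃ (L₃ s₁ s₂ s₃ ∪ L₂ s₁ s₂ s₃)

/-- The graph `A₃'(s₁)`. -/
def A₃min (s₁ : ℕ) : SimpleGraph (Vertex s₁ 1 0) := A₂min s₁ 1 0

/-- The graph `A₃''(s₁)`. -/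
def A₃max (s₁ : ℕ) : SimpleGraph (Vertex s₁ 1 0) :=
  A₃min s₁ ⊔ completeOn ({u₁, u₂, u₃} ∪ L₂ s₁ 1 0)

/-- The graph `A₄'(s₁)`. -/
def A₄min (s₁ : ℕ) : SimpleGraph (Vertex s₁ 2 0) :=
  A₂min s₁ 2 0 ⊔ SimpleGraph.edge (v₃ 0) (v₃ 1)

/-- The graph `A₄''(s₁)`. -/
def A₄max (s₁ : ℕ) : SimpleGraph (Vertex s₁ 2 0) :=
  A₄min s₁ ⊔ SimpleGraph.edge u₁ u₃ ⊔ SimpleGraph.edge u₁ (v₃ 0) ⊔ SimpleGraph.edge u₁ (v₃ 1)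

variable {V : Type*}

/-- `G` belongs, up to isomorphism, to the family `𝒢₁`. -/
def Mem𝒢₁ (G : SimpleGraph V) : Prop :=
  ∃ s₁ s₂ s₃ : ℕ, 3 ≤ s₁ + s₂ + s₃ ∧ Nonempty (G ≃g A₁ s₁ s₂ s₃)

/-- `G` belongs, up to isomorphism, to the family `𝒢₂`. -/
def Mem𝒢₂ (G : SimpleGraph V) : Prop :=
  ∃ s₁ s₂ s₃ : ℕ, 1 ≤ s₂ ∧ 3 ≤ s₁ + s₂ + s₃ ∧ ((1 ≤ s₁ ∧ 1 ≤ s₃) ∨ 2 ≤ s₂) ∧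
    ∃ H : SimpleGraph (Vertex s₁ s₂ s₃),
      A₂min s₁ s₂ s₃ ≤ H ∧ H ≤ A₂max s₁ s₂ s₃ ∧ Nonempty (G ≃g H)

/-- `G` belongs, up to isomorphism, to the family `𝒢₃`. -/
def Mem𝒢₃ (G : SimpleGraph V) : Prop :=
  ∃ s₁ : ℕ, 2 ≤ s₁ ∧
    ∃ H : SimpleGraph (Vertex s₁ 1 0), A₃min s₁ ≤ H ∧ H ≤ A₃max s₁ ∧ Nonempty (G ≃g H)

/-- `G` belongs, up to isomorphism, to the family `𝒢₄`. -/
def Mem𝒢₄ (G : SimpleGraph V) : Prop :=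
  ∃ s₁ : ℕ, 1 ≤ s₁ ∧
    ∃ H : SimpleGraph (Vertex s₁ 2 0), A₄min s₁ ≤ H ∧ H ≤ A₄max s₁ ∧ Nonempty (G ≃g H)

end HypoFamilies

/-!
Let `G` be hypomatchable without a `{P₂, P₉}`-factor. A path of order `9` in `G` whose complement
has a perfect matching gives a factor, and so does such a cycle of order `7`, since an edge leaving
the cycle prolongs it to a path of order `9`. If `x` and `a` are adjacent, two perfect matchings, of
`G - x` and of `G - a`, contain an alternating path from `x` to `a`, which together with the edge
`x a` is an odd cycle whose complement is perfectly matched. Hence its order is `3` or `5`. If some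
such cycle has order `5`, every edge of the complementary matching is a component outside the cycle,
and the ways in which these components may attach to the cycle without creating a long path or cycle
give `𝒢₂`, `𝒢₃` and `𝒢₄`. Otherwise, a suitable triangle dominates `G`, each edge of its
complementary matching is attached to exactly one vertex of the triangle, and `G` lies in `𝒢₁`.
-/

open SimpleGraph HypoFamilies

section Pairing

variable {V : Type*} {G : SimpleGraph V} {f : V → V} {l : List V}

/-- `f` is the partner map of a perfect matching of the subgraph of `G` induced on `S`. Its values
outside `S` are irrelevant. -/
def IsPairing (G : SimpleGraph V) (f : V → V) (S : Set V) : Prop :=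
  ∀ v ∈ S, f v ∈ S ∧ G.Adj v (f v) ∧ f (f v) = v

theorem Hypomatchable.exists_isPairing (hG : Hypomatchable G) (x : V) :
    ∃ f, IsPairing G f {x}ᶜ := by
  classical
  obtain ⟨M, hM⟩ := hG x
  choose g hg hunique using fun v : ({x}ᶜ : Set V) => hM.1 (hM.2 v)
  refine ⟨fun v => if hv : v ∈ ({x}ᶜ : Set V) then g ⟨v, hv⟩ else v, fun v hv => ?_⟩
  have hgv : (g ⟨v, hv⟩ : V) ∈ ({x}ᶜ : Set V) := (g ⟨v, hv⟩).2
  simp only [dif_pos hv, dif_pos hgv]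
  exact ⟨hgv, (hg ⟨v, hv⟩).adj_sub, congrArg Subtype.val (hunique _ _ (hg ⟨v, hv⟩).symm).symm⟩

theorem Hypomatchable.exists_adj_ne (hG : Hypomatchable G) {v w : V} (h : v ≠ w) :
    ∃ u, u ≠ w ∧ G.Adj v u := by
  obtain ⟨f, hf⟩ := hG.exists_isPairing w
  exact ⟨f v, (hf v h).1, (hf v h).2.1⟩

/-- The entries of `l` are distinct, and `f` pairs up all the other vertices of `G`. A path or a
cycle on such a list is *nice* in the terminology of matching theory. -/
structure IsNice (G : SimpleGraph V) (f : V → V) (l : List V) : Prop where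
  nodup : l.Nodup
  isPairing : IsPairing G f {v | v ∉ l}

namespace IsNice

theorem perm {l' : List V} (h : IsNice G f l) (hl : l.Perm l') : IsNice G f l' where
  nodup := hl.nodup_iff.1 h.nodup
  isPairing := by simpa only [hl.mem_iff] using h.isPairing

theorem notMem_mate {v : V} (h : IsNice G f l) (hv : v ∉ l) : f v ∉ l := (h.isPairing v hv).1

theorem adj_mate {v : V} (h : IsNice G f l) (hv : v ∉ l) : G.Adj v (f v) := (h.isPairing v hv).2.1

theorem mate_mate {v : V} (h : IsNice G f l) (hv : v ∉ l) : f (f v) = v := (h.isPairing v hv).2.2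

theorem mate_eq_iff {v w : V} (h : IsNice G f l) (hv : v ∉ l) (hw : w ∉ l) :
    f v = w ↔ v = f w :=
  ⟨fun e => e ▸ (h.mate_mate hv).symm, fun e => e ▸ h.mate_mate hw⟩

theorem cons_mate {c : V} (h : IsNice G f l) (hc : c ∉ l) : IsNice G f (c :: f c :: l) where
  nodup := by
    simp [h.nodup, hc, h.notMem_mate hc, (h.adj_mate hc).ne]
  isPairing v hv := by
    simp only [Set.mem_ofPred_eq, List.mem_cons, not_or] at hv ⊢
    obtain ⟨hvc, hvfc, hv⟩ := hv
    refine ⟨⟨?_, ?_, h.notMem_mate hv⟩, h.adj_mate hv, h.mate_mate hv⟩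
    · rwa [h.mate_eq_iff hv hc]
    · rwa [h.mate_eq_iff hv (h.notMem_mate hc), h.mate_mate hc]

theorem exists_erase {a b : V} (h : IsNice G f (a :: b :: l)) (hab : G.Adj a b) :
    ∃ f', IsNice G f' l ∧ f' a = b ∧ f' b = a ∧ ∀ v, v ∉ a :: b :: l → f' v = f v := by
  classical
  obtain ⟨hal, hbl, hl⟩ : a ∉ l ∧ b ∉ l ∧ l.Nodup := by grind [h.nodup]
  refine ⟨Function.update (Function.update f b a) a b, ⟨hl, fun v hv => ?_⟩, by simp,
    by simp [hab.ne'], fun v hv => by grind⟩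
  rcases eq_or_ne v a with rfl | hva
  · simpa [hab.ne', hbl] using hab
  rcases eq_or_ne v b with rfl | hvb
  · simpa [hab.ne, hva, hal] using hab.symm
  have := h.isPairing v
  grind

end IsNice

end Pairing

section Factor

variable {V W : Type*}

theorem nonempty_component_iso {F : SimpleGraph V} {H : SimpleGraph W} (φ : H ↪g F)
    (hH : H.Preconnected) (hφ : ∀ i v, F.Adj (φ i) v → v ∈ Set.range φ) (i₀ : W) :
    Nonempty ((F.connectedComponentMk (φ i₀)).toSimpleGraph ≃g H) := by
  have hclosed (v : V) (h : F.Reachable (φ i₀) v) : v ∈ Set.range φ := by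
    obtain ⟨w⟩ := h
    by_contra hv
    obtain ⟨d, -, ⟨i, hi⟩, hd⟩ := w.exists_boundary_dart _ (Set.mem_range_self i₀) hv
    exact hd (hφ i _ (hi ▸ d.adj))
  let ψ (i : W) : F.connectedComponentMk (φ i₀) :=
    ⟨φ i, ConnectedComponent.sound ((hH i i₀).map φ.toHom)⟩
  have hψ : Function.Bijective ψ := by
    refine ⟨fun i j h => φ.injective (congrArg Subtype.val h), ?_⟩
    rintro ⟨v, hv⟩
    obtain ⟨i, rfl⟩ := hclosed v (ConnectedComponent.exact hv).symm
    exact ⟨i, rfl⟩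
  exact ⟨(⟨Equiv.ofBijective ψ hψ, φ.map_adj_iff⟩ : H ≃g _).symm⟩

/-- The copy of `H` given by `ψ`, together with the edges `v (f v)` for `v` outside this copy. -/
def copyWithPairs (H : SimpleGraph W) (ψ : W ↪ V) (f : V → V) : SimpleGraph V :=
  H.map ψ ⊔ fromRel fun v w => v ∉ Set.range ψ ∧ f v = w

variable {G : SimpleGraph V} {H : SimpleGraph W} {ψ : W ↪ V} {f : V → V}

theorem copyWithPairs_adj_apply (hf : IsPairing G f (Set.range ψ)ᶜ) {i : W} {v : V} :
    (copyWithPairs H ψ f).Adj (ψ i) v ↔ ∃ j, ψ j = v ∧ H.Adj i j := by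
  simp only [copyWithPairs, sup_adj, SimpleGraph.map_adj, fromRel_adj]
  constructor
  · rintro (⟨i', j, h, hi, hj⟩ | ⟨-, ⟨hi, -⟩ | ⟨hv, hi⟩⟩)
    · exact ⟨j, hj, ψ.injective hi ▸ h⟩
    · exact absurd (Set.mem_range_self i) hi
    · exact absurd ⟨i, hi.symm⟩ (hf v hv).1
  · rintro ⟨j, rfl, h⟩
    exact Or.inl ⟨i, j, h, rfl, rfl⟩

theorem copyWithPairs_adj_of_notMem (hf : IsPairing G f (Set.range ψ)ᶜ) {v w : V}
    (hv : v ∉ Set.range ψ) : (copyWithPairs H ψ f).Adj v w ↔ f v = w := by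
  simp only [copyWithPairs, sup_adj, SimpleGraph.map_adj, fromRel_adj]
  constructor
  · rintro (⟨i, -, -, rfl, -⟩ | ⟨-, ⟨-, h⟩ | ⟨hw, rfl⟩⟩)
    · exact absurd (Set.mem_range_self i) hv
    · exact h
    · exact (hf w hw).2.2
  · rintro rfl
    exact Or.inr ⟨(hf v hv).2.1.ne, Or.inl ⟨hv, rfl⟩⟩

theorem copyWithPairs_le (hf : IsPairing G f (Set.range ψ)ᶜ) (hψ : H.map ψ ≤ G) :
    copyWithPairs H ψ f ≤ G := by
  refine sup_le hψ fun v w h => ?_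
  obtain ⟨-, ⟨hv, rfl⟩ | ⟨hw, rfl⟩⟩ := (fromRel_adj _ _ _).1 h
  · exact (hf v hv).2.1
  · exact (hf w hw).2.1.symm

theorem nonempty_component_copyWithPairs_iso (hf : IsPairing G f (Set.range ψ)ᶜ)
    (hH : H.Preconnected) (i : W) :
    Nonempty (((copyWithPairs H ψ f).connectedComponentMk (ψ i)).toSimpleGraph ≃g H) :=
  nonempty_component_iso (φ := ⟨ψ, by simp [copyWithPairs_adj_apply hf]⟩) hH
    (fun i v h => ((copyWithPairs_adj_apply hf).1 h).imp fun _ hj => hj.1) i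

theorem nonempty_component_copyWithPairs_iso_pathGraph_two (hf : IsPairing G f (Set.range ψ)ᶜ)
    {v : V} (hv : v ∉ Set.range ψ) :
    Nonempty (((copyWithPairs H ψ f).connectedComponentMk v).toSimpleGraph ≃g pathGraph 2) := by
  obtain ⟨hfv, hadj, hffv⟩ := hf v hv
  have hvw (w : V) := copyWithPairs_adj_of_notMem (H := H) (w := w) hf hv
  have hfvw (w : V) := copyWithPairs_adj_of_notMem (H := H) (w := w) hf hfv
  rw [hffv] at hfvw
  have hinj : Function.Injective ![v, f v] := fun i j => by
    fin_cases i <;> fin_cases j <;> simp [hadj.ne, hadj.ne']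
  have hφ (i j : Fin 2) :
      (copyWithPairs H ψ f).Adj (![v, f v] i) (![v, f v] j) ↔ (pathGraph 2).Adj i j := by
    fin_cases i <;> fin_cases j <;> simp [pathGraph_adj, hvw, hfvw]
  refine nonempty_component_iso (φ := ⟨⟨_, hinj⟩, hφ _ _⟩) (pathGraph_preconnected 2) ?_ 0
  rw [Fin.forall_fin_two]
  exact ⟨fun w h => ⟨1, (hvw w).1 h⟩, fun w h => ⟨0, (hfvw w).1 h⟩⟩

theorem IsNice.hasPathFactor {l : List V} (h : IsNice G f l) (hl : l.IsChain G.Adj) :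
    HasPathFactor {2, l.length} G := by
  let ψ : Fin l.length ↪ V := ⟨l.get, h.nodup.injective_get⟩
  have hf : IsPairing G f (Set.range ψ)ᶜ := by
    convert h.isPairing using 1
    ext v
    simp [ψ]
  refine ⟨copyWithPairs (pathGraph l.length) ψ f, copyWithPairs_le hf ?_, fun C => ?_⟩
  · rw [map_le_iff_le_comap]
    intro i j hij
    have hstep := List.isChain_iff_getElem.1 hl
    rcases pathGraph_adj.1 hij with h | h
    · simpa [ψ, h] using hstep i (by lia)
    · simpa [ψ, h] using (hstep j (by lia)).symm
  · induction C using ConnectedComponent.ind with | h v =>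
    by_cases hv : v ∈ Set.range ψ
    · obtain ⟨i, rfl⟩ := hv
      exact ⟨_, Or.inr rfl,
        nonempty_component_copyWithPairs_iso hf (pathGraph_preconnected _) i⟩
    · exact ⟨2, Or.inl rfl, nonempty_component_copyWithPairs_iso_pathGraph_two hf hv⟩

end Factor

section AlternatingPath

variable {V : Type*} {G : SimpleGraph V} {f g : V → V} {x a u : V} {l : List V}

/-- The list `u :: l` is a path from `u` to `x` whose edges alternate between pairs of `f` and
pairs of `g`: outside `u :: l` the vertices are paired by `f`, and within `l` they are paired
by `g`. -/
structure IsAlternatingPath (G : SimpleGraph V) (f g : V → V) (x u : V) (l : List V) : Prop where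
  isNice : IsNice G f (u :: l)
  isChain : (u :: l).IsChain G.Adj
  getLast_eq : (u :: l).getLast (List.cons_ne_nil _ _) = x
  isPairing : IsPairing G g {v | v ∈ l}

theorem IsAlternatingPath.extend (h : IsAlternatingPath G f g x u l) (hg : IsPairing G g {a}ᶜ)
    (hu : u ≠ a) : IsAlternatingPath G f g x (f (g u)) (g u :: u :: l) := by
  obtain ⟨-, hadj, hgg⟩ := hg u hu
  have hul : u ∉ l := (List.nodup_cons.1 h.isNice.nodup).1
  have hgl : g u ∉ u :: l := by
    rw [List.mem_cons, not_or]
    exact ⟨hadj.ne', fun hm => hul (hgg ▸ (h.isPairing _ hm).1)⟩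
  refine ⟨(h.isNice.cons_mate hgl).perm (.swap _ _ _), ?_, ?_, fun v hv => ?_⟩
  · exact .cons_cons (h.isNice.adj_mate hgl).symm (.cons_cons hadj.symm h.isChain)
  · simpa using h.getLast_eq
  · rcases hv with _ | ⟨_, _ | ⟨_, hv⟩⟩
    · simp [hgg, hadj.symm]
    · simp [hgg, hadj]
    · obtain ⟨hv, hgv⟩ := h.isPairing v hv
      exact ⟨List.mem_cons_of_mem _ (List.mem_cons_of_mem _ hv), hgv⟩

theorem IsAlternatingPath.chain (h : IsAlternatingPath G f g x u l) (hxu : G.Adj x u) :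
    ((u :: l : List V) : Cycle V).Chain G.Adj := by
  rw [Cycle.chain_coe_cons, ← List.cons_append]
  refine h.isChain.append (.singleton u) fun v hv w hw => ?_
  obtain rfl : u = w := by simpa using hw
  rw [List.getLast?_eq_getLast_of_ne_nil (List.cons_ne_nil _ _), h.getLast_eq] at hv
  exact Option.some.inj hv ▸ hxu

theorem exists_isAlternatingPath (hf : IsPairing G f {x}ᶜ) (hg : IsPairing G g {a}ᶜ) (n : ℕ) :
    ∃ k ≤ n, ∃ u l, IsAlternatingPath G f g x u l ∧ l.length = 2 * k ∧ (k < n → u = a) := by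
  induction n with
  | zero =>
    refine ⟨0, le_rfl, x, [], ⟨⟨List.nodup_singleton x, ?_⟩, .singleton x, rfl, ?_⟩, rfl, ?_⟩
    · convert hf using 1
      ext v
      simp
    · simp [IsPairing]
    · simp
  | succ n ih =>
    obtain ⟨k, hk, u, l, h, hl, hu⟩ := ih
    by_cases hua : u = a
    · exact ⟨k, by lia, u, l, h, hl, fun _ => hua⟩
    · exact ⟨k + 1, by lia, _, _, h.extend hg hua, by simp [hl, mul_add], by grind⟩

theorem Hypomatchable.preconnected [Finite V] (hG : Hypomatchable G) : G.Preconnected := by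
  intro a x
  have := Fintype.ofFinite V
  obtain ⟨f, hf⟩ := hG.exists_isPairing x
  obtain ⟨g, hg⟩ := hG.exists_isPairing a
  obtain ⟨k, hk, u, l, h, hl, hu⟩ := exists_isAlternatingPath hf hg (Fintype.card V)
  have hcard := h.isNice.nodup.length_le_card
  obtain rfl : u = a := hu (by grind)
  exact ⟨(Walk.ofSupport _ _ h.isChain).copy rfl h.getLast_eq⟩

theorem exists_adj_of_mem_of_notMem (hG : G.Preconnected) {S : Set V} {a b : V} (ha : a ∈ S)
    (hb : b ∉ S) : ∃ u ∈ S, ∃ v ∉ S, G.Adj u v := by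
  obtain ⟨w⟩ := hG a b
  obtain ⟨d, -, hfst, hsnd⟩ := w.exists_boundary_dart S ha hb
  exact ⟨_, hfst, _, hsnd, d.adj⟩

theorem IsNice.exists_longer_path (h : IsNice G f l) (hl : (l : Cycle V).Chain G.Adj)
    (hG : G.Preconnected) {b : V} (ha : a ∈ l) (hb : b ∉ l) :
    ∃ l', IsNice G f l' ∧ l'.IsChain G.Adj ∧ l'.length = l.length + 2 := by
  obtain ⟨u, hu, c, hc, huc⟩ := exists_adj_of_mem_of_notMem (S := {v | v ∈ l}) hG ha hb
  obtain ⟨s, t, rfl⟩ := List.append_of_mem hu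
  have hrot : (s ++ u :: t).Perm (u :: (t ++ s)) := List.perm_append_comm
  rw [show ((s ++ u :: t : List V) : Cycle V) = (u :: (t ++ s) : List V) from
    Cycle.coe_eq_coe.2 List.isRotated_append, Cycle.chain_coe_cons] at hl
  refine ⟨f c :: c :: u :: (t ++ s), ?_, ?_, by simp; lia⟩
  · exact ((h.perm hrot).cons_mate (by rwa [← hrot.mem_iff])).perm (.swap _ _ _)
  · exact .cons_cons (h.adj_mate hc).symm (.cons_cons huc.symm (List.IsChain.left_of_append hl))

end AlternatingPath

section Exceptional

variable {V : Type*} {G : SimpleGraph V} {f : V → V} {l : List V}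

/-- The graphs to be classified. -/
structure IsExceptional [Fintype V] (G : SimpleGraph V) : Prop where
  hypomatchable : Hypomatchable G
  card : 9 ≤ Fintype.card V
  not_hasPathFactor : ¬ HasPathFactor {2, 9} G

/-- A cycle of order `5` in `G` whose complement is paired by `f`. -/
structure NicePentagon (G : SimpleGraph V) (p : ZMod 5 → V) (f : V → V) : Prop where
  isNice_map : IsNice G f ([0, 1, 2, 3, 4].map p)
  adj : ∀ i, G.Adj (p i) (p (i + 1))

theorem IsNice.exists_nicePentagon (h : IsNice G f l) (hl : l.length = 5)
    (hc : (l : Cycle V).Chain G.Adj) : ∃ p, NicePentagon G p f := by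
  obtain ⟨a, b, c, d, e, rfl⟩ : ∃ a b c d e, l = [a, b, c, d, e] :=
    match l, hl with | [a, b, c, d, e], _ => ⟨a, b, c, d, e, rfl⟩
  simp only [Cycle.chain_coe_cons, List.cons_append, List.nil_append, List.isChain_cons_cons,
    List.isChain_singleton, and_true] at hc
  refine ⟨![a, b, c, d, e], h, fun i => ?_⟩
  obtain ⟨hab, hbc, hcd, hde, hea⟩ := hc
  fin_cases i <;> assumption

variable [Fintype V]

theorem IsExceptional.not_isNice_path (hG : IsExceptional G) (hl : l.length = 9)
    (hc : l.IsChain G.Adj) : ¬ IsNice G f l :=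
  fun h => hG.not_hasPathFactor (hl ▸ h.hasPathFactor hc)

theorem IsExceptional.exists_notMem (hG : IsExceptional G) (hl : l.length < 9) : ∃ b, b ∉ l := by
  classical
  by_contra! h
  have hcard := l.toFinset_card_le
  rw [Finset.eq_univ_of_forall fun v => List.mem_toFinset.2 (h v), Finset.card_univ] at hcard
  have := hG.card
  lia

theorem IsExceptional.not_isNice_heptagon (hG : IsExceptional G) (hl : l.length = 7)
    (hc : (l : Cycle V).Chain G.Adj) : ¬ IsNice G f l := by
  intro h
  obtain ⟨a, ha⟩ := List.exists_mem_of_length_pos (l := l) (by lia)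
  obtain ⟨b, hb⟩ := hG.exists_notMem (l := l) (by lia)
  obtain ⟨l', hl', hc', hlen⟩ := h.exists_longer_path hc hG.hypomatchable.preconnected ha hb
  exact hG.not_isNice_path (by lia) hc' hl'

/-- Follow the alternating path from `x` towards `a`: it has at most `4` pairs of each kind, and
together with the edge `x a` it closes up to an odd cycle. -/
theorem IsExceptional.adj_mate_or_exists_nicePentagon (hG : IsExceptional G) {x a : V}
    (hf : IsPairing G f {x}ᶜ) (hxa : G.Adj x a) :
    G.Adj x (f a) ∨ ∃ p, NicePentagon G p f := by
  obtain ⟨g, hg⟩ := hG.hypomatchable.exists_isPairing a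
  obtain ⟨k, hk, u, l, h, hl, hu⟩ := exists_isAlternatingPath hf hg 4
  have hxu (hk : k < 4) : G.Adj x u := hu hk ▸ hxa
  interval_cases k
  · obtain rfl := List.length_eq_zero_iff.1 hl
    exact absurd h.getLast_eq (hxu (by lia)).ne'
  · obtain rfl := hu (by lia)
    obtain ⟨c, y, rfl⟩ := List.length_eq_two.1 hl
    obtain rfl : y = x := h.getLast_eq
    have hfu := hf u hxa.ne'
    have hmem : f u ∈ [u, c, y] := by
      by_contra hm
      simpa [hfu.2.2] using h.isNice.notMem_mate hm
    obtain rfl : f u = c := by simpa [hfu.1, hfu.2.1.ne', show f u ≠ y from hfu.1] using hmem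
    left
    simpa [adj_comm] using h.isChain.tail
  · exact Or.inr (h.isNice.exists_nicePentagon (by simp [hl]) (h.chain (hxu (by lia))))
  · exact absurd h.isNice (hG.not_isNice_heptagon (by simp [hl]) (h.chain (hxu (by lia))))
  · exact absurd h.isNice (hG.not_isNice_path (by simp [hl]) h.isChain)

end Exceptional

theorem exists_equiv_fin_prod_bool {α : Type*} [Finite α] {g : α → α} {P : α → Prop}
    (hg : Function.Involutive g) (hne : ∀ a, g a ≠ a) (hP : ∀ a, P a ∨ P (g a)) :
    ∃ (s : ℕ) (e : Fin s × Bool ≃ α),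
      (∀ j b, g (e (j, b)) = e (j, !b)) ∧ ∀ j, P (e (j, false)) := by
  let r : Setoid α :=
    { r := fun a b => a = b ∨ g a = b
      iseqv := by
        refine ⟨fun a => Or.inl rfl, ?_, ?_⟩
        · rintro a b (rfl | rfl)
          exacts [Or.inl rfl, Or.inr (hg a)]
        · rintro a b c (rfl | rfl) (rfl | rfl)
          exacts [Or.inl rfl, Or.inr rfl, Or.inr rfl, Or.inl (hg a).symm] }
  have hrep (q : Quotient r) : ∃ a, ⟦a⟧ = q ∧ P a := by
    induction q using Quotient.ind with | _ a =>
    exact (hP a).elim (fun h => ⟨a, rfl, h⟩) fun h => ⟨g a, Quotient.sound (Or.inr (hg a)), h⟩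
  choose a ha hPa using hrep
  let φ (x : Quotient r × Bool) : α := bif x.2 then g (a x.1) else a x.1
  have hφ : Function.Bijective φ := by
    constructor
    · rintro ⟨q, b⟩ ⟨q', b'⟩ h
      have hmk (q b) : ⟦φ (q, b)⟧ = q := by
        cases b
        · exact ha q
        · exact (Quotient.sound (Or.inr (hg _))).trans (ha q)
      obtain rfl : q = q' := by rw [← hmk q b, h, hmk]
      cases b <;> cases b' <;> first | rfl | exact absurd h (hne _) | exact absurd h.symm (hne _)
    · intro c
      rcases Quotient.exact (ha ⟦c⟧) with h | h
      · exact ⟨(⟦c⟧, false), h⟩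
      · exact ⟨(⟦c⟧, true), h⟩
  let E := Finite.equivFin (Quotient r)
  refine ⟨_, (E.symm.prodCongr (Equiv.refl Bool)).trans (Equiv.ofBijective φ hφ), ?_, fun j => ?_⟩
  · rintro j (_ | _)
    · rfl
    · exact hg _
  · exact hPa _

theorem IsPairing.exists_equiv_fin_prod_bool {V : Type*} [Finite V] {G : SimpleGraph V} {f : V → V}
    {S : Set V} {P : V → Prop} (hf : IsPairing G f S) (hP : ∀ v ∈ S, P v ∨ P (f v)) :
    ∃ (s : ℕ) (e : Fin s × Bool ≃ S),
      (∀ j b, f (e (j, b)) = e (j, !b)) ∧ ∀ j, P (e (j, false)) := by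
  let g (v : S) : S := ⟨f v, (hf v v.2).1⟩
  obtain ⟨s, e, he, heP⟩ := _root_.exists_equiv_fin_prod_bool (g := g) (P := fun v => P v)
    (fun v => Subtype.ext (hf v v.2).2.2)
    (fun v h => (hf v v.2).2.1.ne' (congrArg Subtype.val h)) fun v => hP v v.2
  exact ⟨s, e, fun j b => congrArg Subtype.val (he j b), heP⟩

theorem le_of_forall_adj_of_notMem {α : Type*} {H A : SimpleGraph α} {S : Set α}
    (hS : ∀ a ∈ S, ∀ z ∈ S, H.Adj a z → A.Adj a z) (h : ∀ a ∉ S, ∀ z, H.Adj a z → A.Adj a z) :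
    H ≤ A := by
  intro a z haz
  by_cases ha : a ∈ S
  · by_cases hz : z ∈ S
    · exact hS a ha z hz haz
    · exact (h z hz a haz.symm).symm
  · exact h a ha z haz

namespace HypoFamilies

section Families

variable {s₁ s₂ s₃ : ℕ}

namespace Vertex

/-- The vertices of the path `Q`. -/
def hub : Fin 3 → Vertex s₁ s₂ s₃ := ![u₁, u₂, u₃]

/-- The other vertex of the path `L_{i,j}` through a given vertex. The vertices of `Q` are fixed. -/
def mate : Vertex s₁ s₂ s₃ → Vertex s₁ s₂ s₃
  | x₁ j b => x₁ j !b
  | v₁ j => v₃ j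
  | v₃ j => v₁ j
  | x₃ j b => x₃ j !b
  | a => a

/-- The index `i - 1` of the paths `L_{i,j}` through a given vertex, or of the vertex `u_i`. -/
def kind : Vertex s₁ s₂ s₃ → Fin 3
  | u₁ => 0
  | u₂ => 1
  | u₃ => 2
  | x₁ _ _ => 0
  | v₁ _ => 1
  | v₃ _ => 1
  | x₃ _ _ => 2

/-- The vertices of the path `Q` and those of the paths `L_{i,j}`. -/
def sumEquiv (s : Fin 3 → ℕ) :
    Fin 3 ⊕ (Σ i, Fin (s i) × Bool) ≃ Vertex (s 0) (s 1) (s 2) where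
  toFun
    | .inl i => hub i
    | .inr ⟨0, j, b⟩ => x₁ j b
    | .inr ⟨1, j, false⟩ => v₁ j
    | .inr ⟨1, j, true⟩ => v₃ j
    | .inr ⟨2, j, b⟩ => x₃ j b
  invFun
    | u₁ => .inl 0
    | u₂ => .inl 1
    | u₃ => .inl 2
    | x₁ j b => .inr ⟨0, j, b⟩
    | v₁ j => .inr ⟨1, j, false⟩
    | v₃ j => .inr ⟨1, j, true⟩
    | x₃ j b => .inr ⟨2, j, b⟩
  left_inv
    | .inl i => by fin_cases i <;> rfl
    | .inr ⟨0, j, b⟩ => rfl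
    | .inr ⟨1, j, b⟩ => by cases b <;> rfl
    | .inr ⟨2, j, b⟩ => rfl
  right_inv a := by cases a <;> rfl

theorem kind_sumEquiv_inr (s : Fin 3 → ℕ) (i : Fin 3) (j : Fin (s i)) (b : Bool) :
    kind (sumEquiv s (.inr ⟨i, j, b⟩)) = i := by
  fin_cases i <;> cases b <;> rfl

theorem mate_sumEquiv_inr (s : Fin 3 → ℕ) (i : Fin 3) (j : Fin (s i)) (b : Bool) :
    mate (sumEquiv s (.inr ⟨i, j, b⟩)) = sumEquiv s (.inr ⟨i, j, !b⟩) := by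
  fin_cases i <;> cases b <;> rfl

end Vertex

open Vertex

variable {a z : Vertex s₁ s₂ s₃}

theorem cases_of_notMem_range_hub (ha : a ∉ Set.range hub) :
    (∃ j b, a = x₁ j b) ∨ (∃ j, a = v₁ j) ∨ (∃ j, a = v₃ j) ∨ ∃ j b, a = x₃ j b := by
  match a, ha with
  | u₁, ha => exact absurd ⟨0, rfl⟩ ha
  | u₂, ha => exact absurd ⟨1, rfl⟩ ha
  | u₃, ha => exact absurd ⟨2, rfl⟩ ha
  | x₁ j b, _ => simp
  | v₁ j, _ => simp
  | v₃ j, _ => simp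
  | x₃ j b, _ => simp

theorem v₁_notMem_range_hub (j : Fin s₂) : (v₁ j : Vertex s₁ s₂ s₃) ∉ Set.range hub := by
  rintro ⟨i, h⟩
  fin_cases i <;> cases h

theorem base_adj_iff (ha : a ∉ Set.range hub) : (base s₁ s₂ s₃).Adj a z ↔ z = a.mate := by
  obtain ⟨j, b, rfl⟩ | ⟨j, rfl⟩ | ⟨j, rfl⟩ | ⟨j, b, rfl⟩ := cases_of_notMem_range_hub ha
  all_goals
    constructor
    · rintro ⟨-, h | h⟩ <;> cases h <;> rfl
    · rintro rfl
      try cases b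
      all_goals simp [base, mate, BaseEdge.l₁, BaseEdge.l₂, BaseEdge.l₃]

theorem A₁_adj_hub_iff {i j : Fin 3} : (A₁ s₁ s₂ s₃).Adj (hub i) (hub j) ↔ i ≠ j := by
  fin_cases i <;> fin_cases j <;>
    simp [A₁, base, joinTo, edge_adj, hub, L₁, L₂, L₃, BaseEdge.q₁₂, BaseEdge.q₂₃]

theorem A₁_adj_iff (ha : a ∉ Set.range hub) :
    (A₁ s₁ s₂ s₃).Adj a z ↔ z = a.mate ∨ z = hub a.kind := by
  simp only [A₁, sup_adj, base_adj_iff ha]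
  obtain ⟨j, b, rfl⟩ | ⟨j, rfl⟩ | ⟨j, rfl⟩ | ⟨j, b, rfl⟩ := cases_of_notMem_range_hub ha <;>
  simp [joinTo, edge_adj, hub, kind, mate, L₁, L₂, L₃] <;> grind

theorem A₂min_adj_hub_iff {i j : Fin 3} :
    (A₂min s₁ s₂ s₃).Adj (hub i) (hub j) ↔ (i = 1 ↔ j ≠ 1) := by
  have h₁₃ : ¬ BaseEdge s₁ s₂ s₃ u₁ u₃ := by rintro ⟨⟩
  have h₃₁ : ¬ BaseEdge s₁ s₂ s₃ u₃ u₁ := by rintro ⟨⟩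
  fin_cases i <;> fin_cases j <;>
    simp [A₂min, base, joinTo, hub, BaseEdge.q₁₂, BaseEdge.q₂₃, L₁, L₃, h₁₃, h₃₁]

theorem A₂min_adj_iff (ha : a ∉ Set.range hub) : (A₂min s₁ s₂ s₃).Adj a z ↔
    z = a.mate ∨ (z = hub 0 ∧ (a.kind = 0 ∨ ∃ j, a = v₁ j)) ∨
      (z = hub 2 ∧ (a.kind = 2 ∨ ∃ j, a = v₃ j)) := by
  simp only [A₂min, sup_adj, base_adj_iff ha]
  obtain ⟨j, b, rfl⟩ | ⟨j, rfl⟩ | ⟨j, rfl⟩ | ⟨j, b, rfl⟩ := cases_of_notMem_range_hub ha <;>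
  simp [joinTo, hub, kind, mate, L₁, L₃] <;> grind

theorem A₂max_adj_hub {i j : Fin 3} (hij : i ≠ j) : (A₂max s₁ s₂ s₃).Adj (hub i) (hub j) := by
  fin_cases i <;> fin_cases j <;>
    simp [A₂max, base, joinTo, edge_adj, hub, BaseEdge.q₁₂, BaseEdge.q₂₃] at hij ⊢

theorem A₂max_adj_iff (ha : a ∉ Set.range hub) : (A₂max s₁ s₂ s₃).Adj a z ↔
    z = a.mate ∨ (z = hub 0 ∧ a.kind ≠ 2) ∨ (z = hub 2 ∧ a.kind ≠ 0) := by
  simp only [A₂max, sup_adj, base_adj_iff ha]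
  obtain ⟨j, b, rfl⟩ | ⟨j, rfl⟩ | ⟨j, rfl⟩ | ⟨j, b, rfl⟩ := cases_of_notMem_range_hub ha <;>
  simp [joinTo, edge_adj, hub, kind, mate, L₁, L₂, L₃] <;> grind

variable {s : ℕ}

theorem le_A₃max {H : SimpleGraph (Vertex s 1 0)}
    (h : ∀ a ∉ Set.range hub, a.kind = 0 → ∀ z, H.Adj a z → z = a.mate ∨ z = hub 0) :
    H ≤ A₃max s := by
  have hhub : Set.range hub ∪ L₂ s 1 0 ⊆ {u₁, u₂, u₃} ∪ L₂ s 1 0 := by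
    refine Set.union_subset_union_left _ ?_
    rintro - ⟨i, rfl⟩
    fin_cases i <;> simp [hub]
  refine le_of_forall_adj_of_notMem (S := Set.range hub ∪ L₂ s 1 0) (fun a ha z hz haz => ?_)
    fun a ha z haz => ?_
  · exact Or.inr ((fromRel_adj _ _ _).2 ⟨haz.ne, Or.inl ⟨hhub ha, hhub hz⟩⟩)
  · obtain ⟨ha, haL⟩ := not_or.1 ha
    obtain ⟨j, b, rfl⟩ | ⟨j, rfl⟩ | ⟨j, rfl⟩ | ⟨⟨_, ⟨⟩⟩, -⟩ := cases_of_notMem_range_hub ha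
    · exact Or.inl ((A₂min_adj_iff ha).2 ((h _ ha rfl z haz).imp_right (Or.inl ⟨·, Or.inl rfl⟩)))
    · exact absurd ⟨j, Or.inl rfl⟩ haL
    · exact absurd ⟨j, Or.inr rfl⟩ haL

theorem A₄max_adj_hub {i j : Fin 3} (hij : i ≠ j) : (A₄max s).Adj (hub i) (hub j) := by
  fin_cases i <;> fin_cases j <;>
    simp [A₄max, A₄min, A₂min, base, joinTo, edge_adj, hub, BaseEdge.q₁₂, BaseEdge.q₂₃] at hij ⊢

theorem A₄max_hub_adj_v₃ {i : Fin 3} (hi : i ≠ 1) (j : Fin 2) :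
    (A₄max s).Adj (hub i) (v₃ j) := by
  fin_cases i <;> fin_cases j <;>
    simp [A₄max, A₄min, A₂min, joinTo, edge_adj, hub] at hi ⊢

theorem A₄max_v₃_adj_v₃ {i j : Fin 2} (hij : i ≠ j) : (A₄max s).Adj (v₃ i) (v₃ j) := by
  fin_cases i <;> fin_cases j <;> simp [A₄max, A₄min, edge_adj] at hij ⊢

theorem le_A₄max {H : SimpleGraph (Vertex s 2 0)}
    (h : ∀ a ∉ Set.range hub, a.kind = 0 → ∀ z, H.Adj a z → z = a.mate ∨ z = hub 0)
    (hv₁ : ∀ j z, H.Adj (v₁ j) z → z = v₃ j ∨ z = hub 0) (hv₃ : ∀ j, ¬ H.Adj (v₃ j) (hub 1)) :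
    H ≤ A₄max s := by
  have hmin {a z} (haz : (A₂min s 2 0).Adj a z) : (A₄max s).Adj a z :=
    Or.inl (Or.inl (Or.inl (Or.inl haz)))
  refine le_of_forall_adj_of_notMem (S := Set.range hub ∪ Set.range v₃) ?_ fun a ha z haz => ?_
  · have hne {i j} (hij : H.Adj (hub i) (v₃ j)) : i ≠ 1 := by
      rintro rfl
      exact hv₃ j hij.symm
    rintro - (⟨i, rfl⟩ | ⟨i, rfl⟩) - (⟨j, rfl⟩ | ⟨j, rfl⟩) haz
    · exact A₄max_adj_hub fun hij => haz.ne (hij ▸ rfl)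
    · exact A₄max_hub_adj_v₃ (hne haz) j
    · exact (A₄max_hub_adj_v₃ (hne haz.symm) i).symm
    · exact A₄max_v₃_adj_v₃ fun hij => haz.ne (hij ▸ rfl)
  · obtain ⟨ha, haL⟩ := not_or.1 ha
    obtain ⟨j, b, rfl⟩ | ⟨j, rfl⟩ | ⟨j, rfl⟩ | ⟨⟨_, ⟨⟩⟩, -⟩ := cases_of_notMem_range_hub ha
    · exact hmin ((A₂min_adj_iff ha).2 ((h _ ha rfl z haz).imp_right (Or.inl ⟨·, Or.inl rfl⟩)))
    · exact hmin ((A₂min_adj_iff ha).2 ((hv₁ j z haz).imp_right (Or.inl ⟨·, Or.inr ⟨j, rfl⟩⟩)))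
    · exact absurd ⟨j, rfl⟩ haL

end Families

end HypoFamilies

section Labelling

open Vertex

variable {V : Type*} {G : SimpleGraph V} {w : Fin 3 → V} {f : V → V} {t : V → Fin 3}
  {P : V → Prop} {s₁ s₂ s₃ : ℕ} {e : Vertex s₁ s₂ s₃ ≃ V}

/-- The enumeration `e` of `V` matches the paths `L_{i,j}` with the pairs of `f` off the vertices
`w i`, in such a way that `t` takes the value `i - 1` on `L_{i,j}` and `P` holds at the
vertices `v_{1,j}`. -/
structure IsLabelling (w : Fin 3 → V) (f : V → V) (t : V → Fin 3) (P : V → Prop)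
    (e : Vertex s₁ s₂ s₃ ≃ V) : Prop where
  hub (i : Fin 3) : e (hub i) = w i
  mate : ∀ a ∉ Set.range Vertex.hub, e a.mate = f (e a)
  kind : ∀ a ∉ Set.range Vertex.hub, a.kind = t (e a)
  prop (j : Fin s₂) : P (e (v₁ j))

theorem exists_isLabelling [Finite V] (hw : Function.Injective w)
    (hf : IsPairing G f (Set.range w)ᶜ) (ht : ∀ v ∉ Set.range w, t (f v) = t v)
    (hP : ∀ v ∉ Set.range w, t v = 1 → P v ∨ P (f v)) :
    ∃ (s₁ s₂ s₃ : ℕ) (e : Vertex s₁ s₂ s₃ ≃ V), IsLabelling w f t P e ∧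
      ∀ i, {v | v ∉ Set.range w ∧ t v = i}.ncard = 2 * ![s₁, s₂, s₃] i := by
  classical
  let N (i : Fin 3) : Set V := {v | v ∉ Set.range w ∧ t v = i}
  have hN (i : Fin 3) : IsPairing G f (N i) := fun v hv =>
    ⟨⟨(hf v hv.1).1, (ht v hv.1).trans hv.2⟩, (hf v hv.1).2⟩
  choose s E hE hEP using fun i => (hN i).exists_equiv_fin_prod_bool (P := fun v => i = 1 → P v)
    fun v hv => by
      by_cases hi : i = 1
      · simpa [hi] using hP v hv.1 (hv.2.trans hi)
      · simp [hi]
  let e : Vertex (s 0) (s 1) (s 2) ≃ V := (sumEquiv s).symm.trans <|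
    (Equiv.sumCongr (Equiv.ofInjective w hw) ((Equiv.sigmaCongrRight fun i => (E i).trans
      (Equiv.subtypeSubtypeEquivSubtypeInter _ _).symm).trans
      (Equiv.sigmaFiberEquiv fun v : ((Set.range w)ᶜ : Set V) => t v))).trans
      (Equiv.Set.sumCompl (Set.range w))
  have hub (i) : e (hub i) = w i := by fin_cases i <;> rfl
  have hpair (i j b) : e (sumEquiv s (.inr ⟨i, j, b⟩)) = E i (j, b) := by
    simp only [e, Equiv.trans_apply, Equiv.symm_apply_apply, Equiv.sumCongr_apply, Sum.map_inr,
      Equiv.Set.sumCompl_apply_inr]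
    rfl
  have hcases (a) (ha : a ∉ Set.range Vertex.hub) : ∃ i j b, a = sumEquiv s (.inr ⟨i, j, b⟩) := by
    obtain ⟨i | ⟨i, j, b⟩, rfl⟩ := (sumEquiv s).surjective a
    · exact absurd ⟨i, rfl⟩ ha
    · exact ⟨i, j, b, rfl⟩
  refine ⟨_, _, _, e, ⟨hub, fun a ha => ?_, fun a ha => ?_, fun j => ?_⟩, fun i => ?_⟩
  · obtain ⟨i, j, b, rfl⟩ := hcases a ha
    rw [mate_sumEquiv_inr, hpair, hpair, ← hE]
  · obtain ⟨i, j, b, rfl⟩ := hcases a ha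
    rw [kind_sumEquiv_inr, hpair, (E i (j, b)).2.2]
  · exact hEP 1 j rfl
  · change (N i).ncard = _
    rw [← Nat.card_coe_set_eq, Nat.card_congr (E i).symm, Nat.card_prod, mul_comm]
    fin_cases i <;> simp

theorem three_le_of_equiv (e : Vertex s₁ s₂ s₃ ≃ V) (hV : 9 ≤ Nat.card V) :
    3 ≤ s₁ + s₂ + s₃ := by
  have hcard : Nat.card (Vertex s₁ s₂ s₃) = 3 + (s₁ + s₂ + s₃) * 2 := by
    refine (Nat.card_congr (sumEquiv ![s₁, s₂, s₃])).symm.trans ?_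
    simp [Fin.sum_univ_three, add_mul]
  rw [← Nat.card_congr e, hcard] at hV
  lia

namespace IsLabelling

theorem mem_range_iff {a : Vertex s₁ s₂ s₃} (he : IsLabelling w f t P e) :
    e a ∈ Set.range w ↔ a ∈ Set.range Vertex.hub := by
  simp only [Set.mem_range, ← he.hub, e.injective.eq_iff]

theorem map_v₃ (he : IsLabelling w f t P e) (j : Fin s₂) : e (v₃ j) = f (e (v₁ j)) :=
  he.mate _ (v₁_notMem_range_hub j)

theorem eq_mate_or_eq_hub {a z : Vertex s₁ s₂ s₃} {i : Fin 3} (he : IsLabelling w f t P e)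
    (ha : a ∉ Set.range Vertex.hub) (h : e z = f (e a) ∨ e z = w i) :
    z = a.mate ∨ z = Vertex.hub i := by
  rwa [← he.mate a ha, ← he.hub, e.injective.eq_iff, e.injective.eq_iff] at h

theorem mem𝒢₁ (he : IsLabelling w f t P e) (hV : 9 ≤ Nat.card V)
    (hw : ∀ i j, i ≠ j → G.Adj (w i) (w j))
    (hv : ∀ v ∉ Set.range w, ∀ z, G.Adj v z ↔ z = f v ∨ z = w (t v)) : Mem𝒢₁ G := by
  have hhub (i j : Fin 3) : (G.comap e).Adj (Vertex.hub i) (Vertex.hub j) ↔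
      (A₁ s₁ s₂ s₃).Adj (Vertex.hub i) (Vertex.hub j) := by
    rw [comap_adj, he.hub, he.hub, A₁_adj_hub_iff]
    exact ⟨fun h hij => h.ne (hij ▸ rfl), hw i j⟩
  have hadj (a) (ha : a ∉ Set.range Vertex.hub) (z) :
      (G.comap e).Adj a z ↔ (A₁ s₁ s₂ s₃).Adj a z := by
    rw [comap_adj, hv _ (he.mem_range_iff.not.2 ha), A₁_adj_iff ha, ← he.mate a ha,
      ← he.kind a ha, ← he.hub, e.injective.eq_iff, e.injective.eq_iff]
  have hA : G.comap e = A₁ s₁ s₂ s₃ := by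
    refine le_antisymm
      (le_of_forall_adj_of_notMem (S := Set.range Vertex.hub) ?_ fun a ha z => (hadj a ha z).1)
      (le_of_forall_adj_of_notMem (S := Set.range Vertex.hub) ?_ fun a ha z => (hadj a ha z).2)
    · rintro - ⟨i, rfl⟩ - ⟨j, rfl⟩
      exact (hhub i j).1
    · rintro - ⟨i, rfl⟩ - ⟨j, rfl⟩
      exact (hhub i j).2
  exact ⟨s₁, s₂, s₃, three_le_of_equiv e hV, ⟨hA ▸ (Iso.comap e G).symm⟩⟩

end IsLabelling

/-- The graph `G` contains the edges of `A₂'(s₁, s₂, s₃)`, where `u_i` is the vertex `w (i - 1)`,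
the paths `L_{i,j}` are the pairs of `f` off these vertices, and `t` takes the value `i - 1` on
`L_{i,j}`. -/
structure IsA₂Frame (G : SimpleGraph V) (w : Fin 3 → V) (f : V → V) (t : V → Fin 3) : Prop where
  injective : Function.Injective w
  isPairing : IsPairing G f (Set.range w)ᶜ
  adj₀₁ : G.Adj (w 0) (w 1)
  adj₁₂ : G.Adj (w 1) (w 2)
  index_mate : ∀ v ∉ Set.range w, t (f v) = t v
  adj_zero : ∀ v ∉ Set.range w, t v = 0 → G.Adj (w 0) v
  adj_one : ∀ v ∉ Set.range w, t v = 1 →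
    (G.Adj (w 0) v ∧ G.Adj (w 2) (f v)) ∨ (G.Adj (w 0) (f v) ∧ G.Adj (w 2) v)
  adj_two : ∀ v ∉ Set.range w, t v = 2 → G.Adj (w 2) v

namespace IsA₂Frame

theorem exists_isLabelling [Finite V] (h : IsA₂Frame G w f t) :
    ∃ (s₁ s₂ s₃ : ℕ) (e : Vertex s₁ s₂ s₃ ≃ V),
      IsLabelling w f t (fun v => G.Adj (w 0) v ∧ G.Adj (w 2) (f v)) e ∧
      A₂min s₁ s₂ s₃ ≤ G.comap e ∧
      ∀ i, {v | v ∉ Set.range w ∧ t v = i}.ncard = 2 * ![s₁, s₂, s₃] i := by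
  obtain ⟨s₁, s₂, s₃, e, he, hs⟩ := _root_.exists_isLabelling
    (P := fun v => G.Adj (w 0) v ∧ G.Adj (w 2) (f v)) h.injective h.isPairing h.index_mate
    fun v hv hvt => by
      rw [(h.isPairing v hv).2.2]
      exact h.adj_one v hv hvt
  refine ⟨s₁, s₂, s₃, e, he, ?_, hs⟩
  have hadj₀₁ : (G.comap e).Adj (hub 0) (hub 1) := by simpa only [comap_adj, he.hub] using h.adj₀₁
  have hadj₁₂ : (G.comap e).Adj (hub 1) (hub 2) := by simpa only [comap_adj, he.hub] using h.adj₁₂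
  refine le_of_forall_adj_of_notMem (S := Set.range hub) ?_ fun a ha z haz => ?_
  · rintro - ⟨i, rfl⟩ - ⟨j, rfl⟩ hij
    rw [A₂min_adj_hub_iff] at hij
    fin_cases i <;> fin_cases j <;> first
      | exact absurd hij (by decide)
      | exact hadj₀₁
      | exact hadj₀₁.symm
      | exact hadj₁₂
      | exact hadj₁₂.symm
  · have hea : e a ∉ Set.range w := he.mem_range_iff.not.2 ha
    rw [A₂min_adj_iff ha] at haz
    rw [comap_adj]
    obtain rfl | ⟨rfl, ha₀ | ⟨j, rfl⟩⟩ | ⟨rfl, ha₂ | ⟨j, rfl⟩⟩ := haz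
    · rw [he.mate a ha]
      exact (h.isPairing _ hea).2.1
    · rw [he.hub]
      exact (h.adj_zero _ hea (he.kind a ha ▸ ha₀)).symm
    · rw [he.hub]
      exact (he.prop j).1.symm
    · rw [he.hub]
      exact (h.adj_two _ hea (he.kind a ha ▸ ha₂)).symm
    · rw [he.hub]
      exact he.map_v₃ j ▸ (he.prop j).2.symm

variable [Finite V]

theorem mem𝒢₂ (h : IsA₂Frame G w f t) (hV : 9 ≤ Nat.card V) (h₁ : ∃ v ∉ Set.range w, t v = 1)
    (hs : ((∃ v ∉ Set.range w, t v = 0) ∧ ∃ v ∉ Set.range w, t v = 2) ∨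
      2 < {v | v ∉ Set.range w ∧ t v = 1}.ncard)
    (hmax : ∀ v ∉ Set.range w, ∀ z, G.Adj v z →
      z = f v ∨ (z = w 0 ∧ t v ≠ 2) ∨ (z = w 2 ∧ t v ≠ 0)) : Mem𝒢₂ G := by
  obtain ⟨s₁, s₂, s₃, e, he, hmin, hcard⟩ := h.exists_isLabelling
  have hpos (i) (hi : ∃ v ∉ Set.range w, t v = i) : 0 < ![s₁, s₂, s₃] i := by
    obtain ⟨v, hv⟩ := hi
    have := (Set.ncard_pos (Set.toFinite {v | v ∉ Set.range w ∧ t v = i})).2 ⟨v, hv⟩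
    rw [hcard] at this
    lia
  rw [hcard 1] at hs
  refine ⟨s₁, s₂, s₃, hpos 1 h₁, three_le_of_equiv e hV, ?_, G.comap e, hmin, ?_,
    ⟨(Iso.comap e G).symm⟩⟩
  · exact hs.imp (fun h => ⟨hpos 0 h.1, hpos 2 h.2⟩)
      fun h => lt_of_mul_lt_mul_left h (Nat.zero_le 2)
  · refine le_of_forall_adj_of_notMem (S := Set.range hub) ?_ fun a ha z haz => ?_
    · rintro - ⟨i, rfl⟩ - ⟨j, rfl⟩ hij
      exact A₂max_adj_hub fun h => hij.ne (h ▸ rfl)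
    · have := hmax (e a) (he.mem_range_iff.not.2 ha) (e z) haz
      rw [A₂max_adj_iff ha]
      rwa [← he.mate a ha, ← he.kind a ha, ← he.hub, ← he.hub, e.injective.eq_iff,
        e.injective.eq_iff, e.injective.eq_iff] at this

theorem mem𝒢₃ (h : IsA₂Frame G w f t) (hV : 9 ≤ Nat.card V)
    (h₁ : {v | v ∉ Set.range w ∧ t v = 1}.ncard = 2)
    (h₂ : {v | v ∉ Set.range w ∧ t v = 2}.ncard = 0)
    (hmax : ∀ v ∉ Set.range w, t v = 0 → ∀ z, G.Adj v z → z = f v ∨ z = w 0) : Mem𝒢₃ G := by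
  obtain ⟨s₁, s₂, s₃, e, he, hmin, hcard⟩ := h.exists_isLabelling
  obtain rfl : s₂ = 1 := Nat.eq_of_mul_eq_mul_left two_pos ((hcard 1).symm.trans h₁)
  obtain rfl : s₃ = 0 := Nat.eq_of_mul_eq_mul_left two_pos ((hcard 2).symm.trans h₂)
  have := three_le_of_equiv e hV
  refine ⟨s₁, by lia, G.comap e, hmin, le_A₃max fun a ha ha₀ z haz => ?_, ⟨(Iso.comap e G).symm⟩⟩
  exact he.eq_mate_or_eq_hub ha (hmax _ (he.mem_range_iff.not.2 ha) (he.kind a ha ▸ ha₀) _ haz)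

theorem mem𝒢₄ (h : IsA₂Frame G w f t) (hV : 9 ≤ Nat.card V)
    (h₁ : {v | v ∉ Set.range w ∧ t v = 1}.ncard = 4)
    (h₂ : {v | v ∉ Set.range w ∧ t v = 2}.ncard = 0)
    (hmax : ∀ v ∉ Set.range w, t v = 0 ∨ (t v = 1 ∧ G.Adj (w 2) (f v)) →
      ∀ z, G.Adj v z → z = f v ∨ z = w 0)
    (hw : ∀ v ∉ Set.range w, t v = 1 → G.Adj (w 2) v → ¬ G.Adj v (w 1))
    (hadj : {v | v ∉ Set.range w ∧ t v = 1 ∧ G.Adj (w 2) v}.Pairwise G.Adj) : Mem𝒢₄ G := by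
  obtain ⟨s₁, s₂, s₃, e, he, hmin, hcard⟩ := h.exists_isLabelling
  obtain rfl : s₂ = 2 := Nat.eq_of_mul_eq_mul_left two_pos ((hcard 1).symm.trans h₁)
  obtain rfl : s₃ = 0 := Nat.eq_of_mul_eq_mul_left two_pos ((hcard 2).symm.trans h₂)
  have := three_le_of_equiv e hV
  have hv₁ (j) : e (v₁ j) ∉ Set.range w := he.mem_range_iff.not.2 (v₁_notMem_range_hub j)
  have ht (j) : t (e (v₁ j)) = 1 := (he.kind _ (v₁_notMem_range_hub j)).symm
  have hv₃ (j) : e (v₃ j) ∉ Set.range w ∧ t (e (v₃ j)) = 1 ∧ G.Adj (w 2) (e (v₃ j)) := by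
    rw [he.map_v₃ j]
    exact ⟨(h.isPairing _ (hv₁ j)).1, (h.index_mate _ (hv₁ j)).trans (ht j), (he.prop j).2⟩
  refine ⟨s₁, by lia, G.comap e, sup_le hmin ((edge_le_iff _).2 (Or.inr ?_)),
    le_A₄max (fun a ha ha₀ z haz => ?_) (fun j z hz => ?_) fun j hj => ?_, ⟨(Iso.comap e G).symm⟩⟩
  · exact hadj (hv₃ 0) (hv₃ 1) (e.injective.ne (by simp))
  · exact he.eq_mate_or_eq_hub ha
      (hmax _ (he.mem_range_iff.not.2 ha) (Or.inl (he.kind a ha ▸ ha₀)) _ haz)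
  · exact he.eq_mate_or_eq_hub (v₁_notMem_range_hub j)
      (hmax _ (hv₁ j) (Or.inr ⟨ht j, (he.prop j).2⟩) _ hz)
  · obtain ⟨hjw, hjt, hj₂⟩ := hv₃ j
    exact hw _ hjw hjt hj₂ (he.hub 1 ▸ hj)

end IsA₂Frame

end Labelling

section Triangle

variable {V : Type*} {G : SimpleGraph V} {u : Fin 3 → V} {f : V → V} {i j k : Fin 3} {c v z : V}

/-- A triangle of `G` whose complement is paired by `f`. -/
structure NiceTriangle (G : SimpleGraph V) (u : Fin 3 → V) (f : V → V) : Prop where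
  isNice_map : IsNice G f ([0, 1, 2].map u)
  adj : ∀ i j, i ≠ j → G.Adj (u i) (u j)

theorem IsNice.niceTriangle {a b c : V} (h : IsNice G f [a, b, c]) (hab : G.Adj a b)
    (hac : G.Adj a c) (hbc : G.Adj b c) : NiceTriangle G ![a, b, c] f where
  isNice_map := h
  adj i j hij := by
    fin_cases i <;> fin_cases j <;> first | exact absurd rfl hij | assumption | (symm; assumption)

theorem exists_ne_ne (h : i ≠ j) : ∃ k : Fin 3, i ≠ k ∧ j ≠ k := by
  decide +revert

theorem exists_ne_ne_ne (i : Fin 3) : ∃ j k : Fin 3, i ≠ j ∧ i ≠ k ∧ j ≠ k := by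
  decide +revert

namespace NiceTriangle

theorem isNice (hT : NiceTriangle G u f) (hij : i ≠ j) (hik : i ≠ k) (hjk : j ≠ k) :
    IsNice G f [u i, u j, u k] :=
  hT.isNice_map.perm (List.Perm.map u (l₂ := [i, j, k]) (by revert i j k; decide))

theorem isNice_cons (hT : NiceTriangle G u f) (hij : i ≠ j) (hik : i ≠ k) (hjk : j ≠ k)
    (hv : v ∉ Set.range u) : IsNice G f [v, f v, u i, u j, u k] :=
  (hT.isNice hij hik hjk).cons_mate (by grind)

theorem isNice_cons_cons (hT : NiceTriangle G u f) (hij : i ≠ j) (hik : i ≠ k) (hjk : j ≠ k)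
    (hv : v ∉ Set.range u) (hz : z ∉ Set.range u) (hzv : z ≠ v) (hzfv : z ≠ f v) :
    IsNice G f [z, f z, v, f v, u i, u j, u k] :=
  (hT.isNice_cons hij hik hjk hv).cons_mate (by simp only [List.mem_cons, not_or]; grind)

theorem isPairing (hT : NiceTriangle G u f) : IsPairing G f (Set.range u)ᶜ := by
  convert hT.isNice_map.isPairing using 1
  ext v
  simp [Fin.exists_fin_succ, eq_comm]

variable [Fintype V]

theorem adj_mate (hT : NiceTriangle G u f) (hG : IsExceptional G)
    (h₅ : ¬ ∃ p f, NicePentagon G p f) (hc : c ∉ Set.range u) (hic : G.Adj (u i) c) :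
    G.Adj (u i) (f c) := by
  obtain ⟨j, k, hij, hik, hjk⟩ := exists_ne_ne_ne i
  obtain ⟨f', hf', -, -, heq⟩ := (hT.isNice hjk hij.symm hik.symm).exists_erase (hT.adj j k hjk)
  have hpair : IsPairing G f' {u i}ᶜ := by simpa [Set.compl_def] using hf'.isPairing
  rw [← heq c (by grind)]
  exact (hG.adj_mate_or_exists_nicePentagon hpair hic).resolve_right fun ⟨p, hp⟩ => h₅ ⟨p, f', hp⟩

theorem eq_of_adj (hT : NiceTriangle G u f) (hG : IsExceptional G)
    (h₅ : ¬ ∃ p f, NicePentagon G p f) (hc : c ∉ Set.range u) (hi : G.Adj (u i) c)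
    (hj : G.Adj (u j) c) : i = j := by
  by_contra hij
  obtain ⟨k, hik, hjk⟩ := exists_ne_ne hij
  have hnice : IsNice G f [u i, c, f c, u j, u k] :=
    (hT.isNice_cons hij hik hjk hc).perm (by classical grind)
  obtain ⟨p, hp⟩ := hnice.exists_nicePentagon rfl <| by
    simp [hi, (hT.isPairing c hc).2.1, (hT.adj_mate hG h₅ hc hj).symm, hT.adj j k hjk,
      hT.adj k i hik.symm]
  exact h₅ ⟨p, f, hp⟩

theorem not_adj_of_forall_not_adj (hT : NiceTriangle G u f) (hG : IsExceptional G)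
    (h₅ : ¬ ∃ p f, NicePentagon G p f) (hij : i ≠ j) {w q h : V} (hw : w ∉ Set.range u)
    (hq : q ∉ Set.range u) (hh : h ∉ Set.range u) (hiw : G.Adj (u i) w) (hjq : G.Adj (u j) q)
    (hn : ∀ l, ¬ G.Adj (u l) h) : ¬ G.Adj w h := by
  classical
  intro hwh
  obtain ⟨k, hik, hjk⟩ := exists_ne_ne hij
  obtain ⟨hfw, hwfw, -⟩ := hT.isPairing w hw
  have hifw := hT.adj_mate hG h₅ hw hiw
  have hjfq := hT.adj_mate hG h₅ hq hjq
  have hqw : q ≠ w := by rintro rfl; exact hij (hT.eq_of_adj hG h₅ hw hiw hjq)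
  have hqfw : q ≠ f w := by rintro rfl; exact hij (hT.eq_of_adj hG h₅ hfw hifw hjq)
  have hhl : h ∉ [q, f q, w, f w, u i, u k, u j] := by
    have := hwh.ne
    simp only [List.mem_cons, not_or]
    grind
  have hhqw := (hT.isNice_cons_cons hik hij hjk.symm hw hq hqw hqfw).cons_mate hhl
  have hnice : IsNice G f [f h, h, w, f w, u i, u k, u j, q, f q] :=
    hhqw.perm (by grind (gen := 20))
  refine hG.not_isNice_path rfl ?_ hnice
  simp [(hT.isPairing h hh).2.1.symm, hwh.symm, hwfw, hifw.symm, hT.adj i k hik,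
    hT.adj k j hjk.symm, hjq, (hT.isPairing q hq).2.1]

end NiceTriangle

/-- Every vertex outside the triangle `u` is adjacent to a vertex of `u`. -/
def IsFull (G : SimpleGraph V) (u : Fin 3 → V) : Prop :=
  ∀ v ∉ Set.range u, ∃ i, G.Adj (u i) v

theorem exists_adj_of_not_isFull (hG : G.Preconnected) (hu : ¬ IsFull G u) :
    ∃ i, ∃ w ∉ Set.range u, G.Adj (u i) w ∧ ∃ h ∉ Set.range u, G.Adj w h ∧
      ∀ l, ¬ G.Adj (u l) h := by
  simp only [IsFull, not_forall, not_exists] at hu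
  obtain ⟨b, hb, hbn⟩ := hu
  obtain ⟨w, hw, h, hh, hwh⟩ := exists_adj_of_mem_of_notMem hG
    (S := Set.range u ∪ {v | ∃ i, G.Adj (u i) v}) (Or.inl ⟨0, rfl⟩) (not_or.2 ⟨hb, by simpa⟩)
  simp only [Set.mem_union, Set.mem_ofPred_eq, not_or, not_exists] at hh
  have hwu : w ∉ Set.range u := by
    rintro ⟨i, rfl⟩
    exact hh.2 i hwh
  obtain ⟨i, hi⟩ := hw.resolve_left hwu
  exact ⟨i, w, hwu, hi, h, hh.1, hwh, hh.2⟩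

variable [Fintype V]

theorem NiceTriangle.isFull (hT : NiceTriangle G u f) (hG : IsExceptional G)
    (h₅ : ¬ ∃ p f, NicePentagon G p f) (hij : i ≠ j) (hv : v ∉ Set.range u)
    (hz : z ∉ Set.range u) (hiv : G.Adj (u i) v) (hjz : G.Adj (u j) z) : IsFull G u := by
  by_contra hu
  obtain ⟨l, w, hw, hlw, h, hh, hwh, hn⟩ :=
    exists_adj_of_not_isFull hG.hypomatchable.preconnected hu
  rcases eq_or_ne l j with rfl | hlj
  · exact hT.not_adj_of_forall_not_adj hG h₅ hij.symm hw hv hh hlw hiv hn hwh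
  · exact hT.not_adj_of_forall_not_adj hG h₅ hlj hw hz hh hlw hjz hn hwh

theorem IsExceptional.exists_niceTriangle (hG : IsExceptional G)
    (h₅ : ¬ ∃ p f, NicePentagon G p f) : ∃ u f, NiceTriangle G u f := by
  have : Nontrivial V := Fintype.one_lt_card_iff_nontrivial.1 (by have := hG.card; lia)
  obtain ⟨x, y, hxy⟩ := exists_pair_ne V
  obtain ⟨f, hf⟩ := hG.hypomatchable.exists_isPairing x
  obtain ⟨a, -, hxa⟩ := hG.hypomatchable.exists_adj_ne hxy
  have hxfa : G.Adj x (f a) :=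
    (hG.adj_mate_or_exists_nicePentagon hf hxa).resolve_right fun ⟨p, hp⟩ => h₅ ⟨p, f, hp⟩
  have hx : IsNice G f [x] := ⟨List.nodup_singleton x, by simpa [Set.compl_def] using hf⟩
  have hnice : IsNice G f [x, a, f a] :=
    (hx.cons_mate (c := a) (by simpa using hxa.ne')).perm (by classical grind)
  exact ⟨_, f, hnice.niceTriangle hxa hxfa (hf a hxa.ne').2.1⟩

/-- If a triangle is not full, a pendant pair at one of its vertices forms a full triangle with
that vertex. -/
theorem IsExceptional.exists_isFull (hG : IsExceptional G) (h₅ : ¬ ∃ p f, NicePentagon G p f) :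
    ∃ u f, NiceTriangle G u f ∧ IsFull G u := by
  obtain ⟨u, f, hT⟩ := hG.exists_niceTriangle h₅
  by_cases hu : IsFull G u
  · exact ⟨u, f, hT, hu⟩
  obtain ⟨i, d, hd, hid, e, he, hde, hn⟩ :=
    exists_adj_of_not_isFull hG.hypomatchable.preconnected hu
  obtain ⟨j, k, hij, hik, hjk⟩ := exists_ne_ne_ne i
  have hifd := hT.adj_mate hG h₅ hd hid
  obtain ⟨hfd, hdfd, -⟩ := hT.isPairing d hd
  have hnice : IsNice G f [u j, u k, u i, d, f d] :=
    (hT.isNice_cons hij hik hjk hd).perm (by classical grind)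
  obtain ⟨f', hf', -⟩ := hnice.exists_erase (hT.adj j k hjk)
  have hT' := hf'.niceTriangle hid hifd hdfd
  have hrange : Set.range ![u i, d, f d] = {u i, d, f d} := by
    simp only [Matrix.range_cons, Matrix.range_empty, Set.union_empty, Set.singleton_union]
  have hj : u j ∉ Set.range ![u i, d, f d] := by grind [(hT.adj i j hij).ne]
  have he' : e ∉ Set.range ![u i, d, f d] := by grind [hde.ne]
  exact ⟨_, f', hT', hT'.isFull hG h₅ (i := 0) (j := 1) (by decide) hj he' (hT.adj i j hij) hde⟩

namespace NiceTriangle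

theorem eq_mate_of_adj_of_adj (hT : NiceTriangle G u f) (hG : IsExceptional G)
    (h₅ : ¬ ∃ p f, NicePentagon G p f) (hv : v ∉ Set.range u) (hz : z ∉ Set.range u)
    (hiv : G.Adj (u i) v) (hiz : G.Adj (u i) z) (hvz : G.Adj v z) : z = f v := by
  by_contra hne
  obtain ⟨j, k, hij, hik, hjk⟩ := exists_ne_ne_ne i
  have hnice : IsNice G f [u j, u k, u i, f v, v, z, f z] :=
    (hT.isNice_cons_cons hij hik hjk hv hz hvz.ne' hne).perm (by classical grind (gen := 20))
  obtain ⟨f', hf', -⟩ := hnice.exists_erase (hT.adj j k hjk)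
  obtain ⟨p, hp⟩ := hf'.exists_nicePentagon rfl <| by
    simp [hT.adj_mate hG h₅ hv hiv, (hT.isPairing v hv).2.1.symm, hvz, (hT.isPairing z hz).2.1,
      (hT.adj_mate hG h₅ hz hiz).symm]
  exact h₅ ⟨p, f', hp⟩

theorem not_adj_of_ne (hT : NiceTriangle G u f) (hG : IsExceptional G)
    (h₅ : ¬ ∃ p f, NicePentagon G p f) (hij : i ≠ j) (hv : v ∉ Set.range u)
    (hz : z ∉ Set.range u) (hiv : G.Adj (u i) v) (hjz : G.Adj (u j) z) : ¬ G.Adj v z := by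
  intro hvz
  obtain ⟨k, hik, hjk⟩ := exists_ne_ne hij
  have hzfv : z ≠ f v := by
    rintro rfl
    exact hij (hT.eq_of_adj hG h₅ hz (hT.adj_mate hG h₅ hv hiv) hjz)
  have hnice : IsNice G f [u i, f v, v, z, f z, u j, u k] :=
    (hT.isNice_cons_cons hij hik hjk hv hz hvz.ne' hzfv).perm (by classical grind (gen := 20))
  refine hG.not_isNice_heptagon rfl ?_ hnice
  simp [hT.adj_mate hG h₅ hv hiv, (hT.isPairing v hv).2.1.symm, hvz, (hT.isPairing z hz).2.1,
    (hT.adj_mate hG h₅ hz hjz).symm, hT.adj j k hjk, hT.adj k i hik.symm]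

end NiceTriangle

theorem IsExceptional.mem𝒢₁ (hG : IsExceptional G) (h₅ : ¬ ∃ p f, NicePentagon G p f) :
    Mem𝒢₁ G := by
  obtain ⟨u, f, hT, hu⟩ := hG.exists_isFull h₅
  have hinj : Function.Injective u := fun i j hij => by_contra fun h => (hT.adj i j h).ne hij
  choose! t ht using hu
  have hmate {v} (hv : v ∉ Set.range u) : t (f v) = t v :=
    have hfv := (hT.isPairing v hv).1
    hT.eq_of_adj hG h₅ hfv (ht _ hfv) (hT.adj_mate hG h₅ hv (ht v hv))
  obtain ⟨s₁, s₂, s₃, e, he, -⟩ := exists_isLabelling hinj hT.isPairing (fun v hv => hmate hv)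
    (P := fun _ => True) fun _ _ _ => Or.inl trivial
  refine he.mem𝒢₁ (by simpa using hG.card) hT.adj fun v hv z => ⟨fun hvz => ?_, ?_⟩
  · by_cases hz : z ∈ Set.range u
    · obtain ⟨i, rfl⟩ := hz
      exact Or.inr (congrArg u (hT.eq_of_adj hG h₅ hv hvz.symm (ht v hv)))
    · have htv : t v = t z := by_contra fun h =>
        hT.not_adj_of_ne hG h₅ h hv hz (ht v hv) (ht z hz) hvz
      exact Or.inl (hT.eq_mate_of_adj_of_adj hG h₅ hv hz (ht v hv) (htv ▸ ht z hz) hvz)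
  · rintro (rfl | rfl)
    · exact (hT.isPairing v hv).2.1
    · exact (ht v hv).symm

end Triangle

section Pentagon

variable {V : Type*} {G : SimpleGraph V} {p : ZMod 5 → V} {f : V → V} {i j : ZMod 5} {c d : V}

theorem mem_zmod_five (i : ZMod 5) : i ∈ [0, 1, 2, 3, 4] := by decide +revert

namespace NicePentagon

theorem isNice (hp : NicePentagon G p f) (i : ZMod 5) :
    IsNice G f [p i, p (i + 1), p (i + 2), p (i + 3), p (i + 4)] :=
  hp.isNice_map.perm (List.Perm.map p (l₂ := [i, i + 1, i + 2, i + 3, i + 4])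
    (by revert i; decide))

theorem isNice_cons (hp : NicePentagon G p f) (i : ZMod 5) (hc : c ∉ Set.range p) :
    IsNice G f [c, f c, p i, p (i + 1), p (i + 2), p (i + 3), p (i + 4)] :=
  (hp.isNice i).cons_mate (by simp only [List.mem_cons, not_or]; grind)

theorem isNice_cons_cons (hp : NicePentagon G p f) (i : ZMod 5) (hc : c ∉ Set.range p)
    (hd : d ∉ Set.range p) (hdc : d ≠ c) (hdfc : d ≠ f c) :
    IsNice G f [d, f d, c, f c, p i, p (i + 1), p (i + 2), p (i + 3), p (i + 4)] :=
  (hp.isNice_cons i hc).cons_mate (by simp only [List.mem_cons, not_or]; grind)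

theorem injective (hp : NicePentagon G p f) : Function.Injective p := fun i j hij =>
  List.inj_on_of_nodup_map hp.isNice_map.nodup (mem_zmod_five i) (mem_zmod_five j) hij

theorem isPairing (hp : NicePentagon G p f) : IsPairing G f (Set.range p)ᶜ := by
  convert hp.isNice_map.isPairing using 1
  ext v
  simp only [Set.mem_compl_iff, Set.mem_ofPred_eq, List.mem_map]
  exact not_congr ⟨fun ⟨i, hi⟩ => ⟨i, mem_zmod_five i, hi⟩, fun ⟨i, _, hi⟩ => ⟨i, hi⟩⟩

theorem adj_cycle (hp : NicePentagon G p f) (i : ZMod 5) :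
    G.Adj (p i) (p (i + 1)) ∧ G.Adj (p (i + 1)) (p (i + 2)) ∧ G.Adj (p (i + 2)) (p (i + 3)) ∧
      G.Adj (p (i + 3)) (p (i + 4)) ∧ G.Adj (p (i + 4)) (p i) := by
  have hadj {j k : ZMod 5} (hjk : j + 1 = k) : G.Adj (p j) (p k) := hjk ▸ hp.adj j
  exact ⟨hp.adj i, hadj (by decide +revert), hadj (by decide +revert), hadj (by decide +revert),
    hadj (by decide +revert)⟩

theorem range_rotate (k : ZMod 5) : Set.range (fun i => p (i + k)) = Set.range p :=
  (Equiv.addRight k).surjective.range_comp p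

theorem rotate (hp : NicePentagon G p f) (k : ZMod 5) :
    NicePentagon G (fun i => p (i + k)) f where
  isNice_map := by simpa [add_comm] using hp.isNice k
  adj i := by simpa [add_right_comm] using hp.adj (i + k)

variable [Fintype V]

theorem not_adj_mate (hp : NicePentagon G p f) (hG : IsExceptional G) (hc : c ∉ Set.range p)
    (hd : d ∉ Set.range p) (hdc : d ≠ c) (hic : G.Adj (p i) c) : ¬ G.Adj (f c) d := by
  intro hfcd
  have hnice : IsNice G f [f d, d, f c, c, p i, p (i + 1), p (i + 2), p (i + 3), p (i + 4)] :=
    (hp.isNice_cons_cons i hc hd hdc hfcd.ne').perm (by classical grind (gen := 20))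
  obtain ⟨h₀₁, h₁₂, h₂₃, h₃₄, -⟩ := hp.adj_cycle i
  refine hG.not_isNice_path rfl ?_ hnice
  simp [(hp.isPairing d hd).2.1.symm, hfcd.symm, (hp.isPairing c hc).2.1.symm, hic.symm, h₀₁, h₁₂,
    h₂₃, h₃₄]

theorem exists_adj_mate (hp : NicePentagon G p f) (hG : IsExceptional G) (hc : c ∉ Set.range p)
    (hic : G.Adj (p i) c) : ∃ j, G.Adj (p j) (f c) := by
  obtain ⟨d, hdc, hfcd⟩ := hG.hypomatchable.exists_adj_ne (hp.isPairing c hc).2.1.ne'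
  by_cases hd : d ∈ Set.range p
  · obtain ⟨j, rfl⟩ := hd
    exact ⟨j, hfcd.symm⟩
  · exact absurd hfcd (hp.not_adj_mate hG hc hd hdc hic)

theorem exists_adj (hp : NicePentagon G p f) (hG : IsExceptional G) (hc : c ∉ Set.range p) :
    ∃ i, G.Adj (p i) c := by
  by_contra hn
  obtain ⟨v, hv, d, hd, hvd⟩ := exists_adj_of_mem_of_notMem hG.hypomatchable.preconnected
    (S := Set.range p ∪ {v | ∃ i, G.Adj (p i) v}) (Or.inl ⟨0, rfl⟩) (not_or.2 ⟨hc, hn⟩)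
  simp only [Set.mem_union, Set.mem_ofPred_eq, not_or, not_exists] at hd
  have hvp : v ∉ Set.range p := by
    rintro ⟨i, rfl⟩
    exact hd.2 i hvd
  obtain ⟨i, hi⟩ := hv.resolve_left hvp
  obtain ⟨j, hj⟩ := hp.exists_adj_mate hG hvp hi
  obtain ⟨hfv, -, hffv⟩ := hp.isPairing v hvp
  have hdfv : d ≠ f v := by
    rintro rfl
    exact hd.2 j hj
  exact hp.not_adj_mate hG hfv hd.1 hdfv hj (by rwa [hffv])

theorem eq_mate_of_adj (hp : NicePentagon G p f) (hG : IsExceptional G) (hc : c ∉ Set.range p)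
    (hd : d ∉ Set.range p) (hcd : G.Adj c d) : d = f c := by
  by_contra hdfc
  obtain ⟨hfc, -, hffc⟩ := hp.isPairing c hc
  obtain ⟨i, hi⟩ := hp.exists_adj hG hfc
  exact hp.not_adj_mate hG hfc hd hdfc hi (by rwa [hffc])

theorem not_adj_succ (hp : NicePentagon G p f) (hG : IsExceptional G) (hc : c ∉ Set.range p)
    (hd : d ∉ Set.range p) (hdc : d ≠ c) (hic : G.Adj (p i) c) : ¬ G.Adj (p (i + 1)) d := by
  intro hid
  have hcfc := (hp.isPairing c hc).2.1
  obtain ⟨-, h₁₂, h₂₃, h₃₄, h₄₀⟩ := hp.adj_cycle i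
  rcases eq_or_ne d (f c) with rfl | hdfc
  · have hnice : IsNice G f [c, f c, p (i + 1), p (i + 2), p (i + 3), p (i + 4), p i] :=
      (hp.isNice_cons i hc).perm (by classical grind (gen := 20))
    refine hG.not_isNice_heptagon rfl ?_ hnice
    simp [hcfc, hid.symm, h₁₂, h₂₃, h₃₄, h₄₀, hic]
  · have hnice : IsNice G f [f d, d, p (i + 1), p (i + 2), p (i + 3), p (i + 4), p i, c, f c] :=
      (hp.isNice_cons_cons i hc hd hdc hdfc).perm (by classical grind (gen := 20))
    refine hG.not_isNice_path rfl ?_ hnice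
    simp [(hp.isPairing d hd).2.1.symm, hid.symm, h₁₂, h₂₃, h₃₄, h₄₀, hic, hcfc]

theorem not_adj_of_consecutive (hp : NicePentagon G p f) (hG : IsExceptional G)
    (hc : c ∉ Set.range p) (hd : d ∉ Set.range p) (hdc : d ≠ c) (hic : G.Adj (p i) c)
    (hij : j = i + 1 ∨ i = j + 1) : ¬ G.Adj (p j) d := by
  rcases hij with rfl | rfl
  · exact hp.not_adj_succ hG hc hd hdc hic
  · exact fun hjd => hp.not_adj_succ hG hd hc hdc.symm hjd hic

/-- Each of the chords would give a cycle of order `7` through `c` and `f c`. -/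
theorem not_adj_of_adj_two_of_adj_three (hp : NicePentagon G p f) (hG : IsExceptional G)
    (hc : c ∉ Set.range p) (h₂ : G.Adj (p 2) c) (h₃ : G.Adj (p 3) c) (h₀ : G.Adj (p 0) (f c)) :
    ¬ G.Adj (p 1) (p 3) ∧ ¬ G.Adj (p 1) (p 4) ∧ ¬ G.Adj (p 2) (p 4) := by
  classical
  have hcfc := (hp.isPairing c hc).2.1
  obtain ⟨h₀₁, h₁₂, h₂₃, h₃₄, h₄₀⟩ := hp.adj_cycle 0
  have hnice := hp.isNice_cons 0 hc
  simp only [zero_add] at h₀₁ h₁₂ h₂₃ h₃₄ h₄₀ hnice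
  refine ⟨fun h => ?_, fun h => ?_, fun h => ?_⟩
  · refine hG.not_isNice_heptagon (l := [f c, c, p 2, p 1, p 3, p 4, p 0]) rfl ?_
      (hnice.perm (by grind (gen := 20)))
    simp [hcfc.symm, h₂.symm, h₁₂.symm, h, h₃₄, h₄₀, h₀]
  · refine hG.not_isNice_heptagon (l := [f c, c, p 2, p 3, p 4, p 1, p 0]) rfl ?_
      (hnice.perm (by grind (gen := 20)))
    simp [hcfc.symm, h₂.symm, h₂₃, h₃₄, h.symm, h₀₁.symm, h₀]
  · refine hG.not_isNice_heptagon (l := [f c, c, p 3, p 4, p 2, p 1, p 0]) rfl ?_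
      (hnice.perm (by grind (gen := 20)))
    simp [hcfc.symm, h₃.symm, h₃₄, h.symm, h₁₂.symm, h₀₁.symm, h₀]

theorem not_adj_of_adj_zero_of_adj_two (hp : NicePentagon G p f) (hG : IsExceptional G)
    (hc : c ∉ Set.range p) (hd : d ∉ Set.range p) (hdc : d ≠ c) (h₀ : G.Adj (p 0) c)
    (h₂ : G.Adj (p 2) d) : ¬ G.Adj (p 1) (p 3) ∧ ¬ G.Adj (p 1) (p 4) := by
  classical
  have hcfc := (hp.isPairing c hc).2.1
  have hdfd := (hp.isPairing d hd).2.1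
  obtain ⟨h₀₁, h₁₂, h₂₃, h₃₄, h₄₀⟩ := hp.adj_cycle 0
  simp only [zero_add] at h₀₁ h₁₂ h₂₃ h₃₄ h₄₀
  rcases eq_or_ne d (f c) with rfl | hdfc
  · have hnice := hp.isNice_cons 0 hc
    simp only [zero_add] at hnice
    refine ⟨fun h => ?_, fun h => ?_⟩
    · refine hG.not_isNice_heptagon (l := [c, f c, p 2, p 1, p 3, p 4, p 0]) rfl ?_
        (hnice.perm (by grind (gen := 20)))
      simp [hcfc, h₂.symm, h₁₂.symm, h, h₃₄, h₄₀, h₀]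
    · refine hG.not_isNice_heptagon (l := [c, f c, p 2, p 3, p 4, p 1, p 0]) rfl ?_
        (hnice.perm (by grind (gen := 20)))
      simp [hcfc, h₂.symm, h₂₃, h₃₄, h.symm, h₀₁.symm, h₀]
  · have hnice := hp.isNice_cons_cons 0 hc hd hdc hdfc
    simp only [zero_add] at hnice
    refine ⟨fun h => ?_, fun h => ?_⟩
    · refine hG.not_isNice_path (l := [f c, c, p 0, p 4, p 3, p 1, p 2, d, f d]) rfl ?_
        (hnice.perm (by grind (gen := 20)))
      simp [hcfc.symm, h₀.symm, h₄₀.symm, h₃₄.symm, h.symm, h₁₂, h₂, hdfd]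
    · refine hG.not_isNice_path (l := [f c, c, p 0, p 1, p 4, p 3, p 2, d, f d]) rfl ?_
        (hnice.perm (by grind (gen := 20)))
      simp [hcfc.symm, h₀.symm, h₀₁, h, h₃₄.symm, h₂₃.symm, h₂, hdfd]

end NicePentagon

end Pentagon

section Classification

variable {V : Type*} {G : SimpleGraph V} {w : Fin 3 → V} {p : ZMod 5 → V} {f : V → V} {c d v : V}

open Classical in
/-- The index `i` for which the pair `{v, f v}` plays the role of some `L_{i,j}`, shifted to start
at `0`: it is read off from which of `w 0` and `w 2` the pair is attached to. -/
noncomputable def frameIndex (G : SimpleGraph V) (w : Fin 3 → V) (f : V → V) (v : V) : Fin 3 :=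
  if G.Adj (w 2) v ∨ G.Adj (w 2) (f v) then
    if G.Adj (w 0) v ∨ G.Adj (w 0) (f v) then 1 else 2
  else 0

theorem frameIndex_eq_zero_iff :
    frameIndex G w f v = 0 ↔ ¬ G.Adj (w 2) v ∧ ¬ G.Adj (w 2) (f v) := by
  grind [frameIndex]

theorem frameIndex_eq_one_iff :
    frameIndex G w f v = 1 ↔
      (G.Adj (w 0) v ∨ G.Adj (w 0) (f v)) ∧ (G.Adj (w 2) v ∨ G.Adj (w 2) (f v)) := by
  grind [frameIndex]

theorem frameIndex_eq_two_iff :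
    frameIndex G w f v = 2 ↔
      (¬ G.Adj (w 0) v ∧ ¬ G.Adj (w 0) (f v)) ∧ (G.Adj (w 2) v ∨ G.Adj (w 2) (f v)) := by
  grind [frameIndex]

theorem isA₂Frame_frameIndex (hw : Function.Injective w) (hf : IsPairing G f (Set.range w)ᶜ)
    (h₀₁ : G.Adj (w 0) (w 1)) (h₁₂ : G.Adj (w 1) (w 2))
    (h : ∀ v ∉ Set.range w, G.Adj (w 0) v ∨ G.Adj (w 2) v) :
    IsA₂Frame G w f (frameIndex G w f) where
  injective := hw
  isPairing := hf
  adj₀₁ := h₀₁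
  adj₁₂ := h₁₂
  index_mate v hv := by grind [frameIndex, (hf v hv).2.2]
  adj_zero v hv ht := (h v hv).resolve_right (frameIndex_eq_zero_iff.1 ht).1
  adj_one v hv ht := by
    have hv' := h v hv
    have hfv' := h (f v) (hf v hv).1
    rw [frameIndex_eq_one_iff] at ht
    tauto
  adj_two v hv ht := (h v hv).resolve_left (frameIndex_eq_two_iff.1 ht).1.1

namespace NicePentagon

theorem notMem_range_vecCons_iff (hp : NicePentagon G p f) :
    v ∉ Set.range ![p 0, p 1, p 2] ↔ v = p 3 ∨ v = p 4 ∨ v ∉ Set.range p := by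
  by_cases hv : v ∈ Set.range p
  · obtain ⟨i, rfl⟩ := hv
    simp only [Matrix.range_cons, Matrix.range_empty, Set.union_empty, Set.mem_union,
      Set.mem_singleton_iff, hp.injective.eq_iff, Set.mem_range_self, not_true_eq_false, or_false]
    decide +revert
  · refine iff_of_true (fun ⟨i, hi⟩ => hv ?_) (Or.inr (Or.inr hv))
    fin_cases i
    exacts [⟨0, hi⟩, ⟨1, hi⟩, ⟨2, hi⟩]

theorem forall_notMem_range_vecCons (hp : NicePentagon G p f) {P : V → Prop} :
    (∀ v ∉ Set.range ![p 0, p 1, p 2], P v) ↔ P (p 3) ∧ P (p 4) ∧ ∀ v ∉ Set.range p, P v := by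
  simp only [hp.notMem_range_vecCons_iff, or_imp, forall_and, forall_eq]

theorem exists_isA₂Frame (hp : NicePentagon G p f)
    (h : ∀ v ∉ Set.range p, G.Adj (p 0) v ∨ G.Adj (p 2) v) :
    ∃ g t, IsA₂Frame G ![p 0, p 1, p 2] g t ∧ (g (p 3) = p 4 ∧ t (p 3) = 1) ∧
      (g (p 4) = p 3 ∧ t (p 4) = 1) ∧
      ∀ v ∉ Set.range p, g v = f v ∧ t v = frameIndex G ![p 0, p 1, p 2] f v := by
  obtain ⟨h₀₁, h₁₂, h₂₃, h₃₄, h₄₀⟩ := hp.adj_cycle 0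
  simp only [zero_add] at h₀₁ h₁₂ h₂₃ h₃₄ h₄₀
  obtain ⟨g, hg, hg₃, hg₄, hgf⟩ := (hp.isNice 3).exists_erase h₃₄
  replace hg : IsNice G g (List.ofFn ![p 0, p 1, p 2]) := hg
  replace hgf : ∀ v ∉ Set.range p, g v = f v := fun v hv => hgf v (by
    simp only [List.mem_cons, not_or]
    grind)
  refine ⟨g, frameIndex G ![p 0, p 1, p 2] g, isA₂Frame_frameIndex (List.nodup_ofFn.1 hg.nodup) ?_
    h₀₁ h₁₂ ?_, ⟨hg₃, ?_⟩, ⟨hg₄, ?_⟩, fun v hv => ⟨hgf v hv, ?_⟩⟩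
  · simpa only [Set.compl_def, Set.mem_range, List.mem_ofFn] using hg.isPairing
  · exact hp.forall_notMem_range_vecCons.2 ⟨Or.inr h₂₃, Or.inl h₄₀.symm, h⟩
  · exact frameIndex_eq_one_iff.2 ⟨Or.inr (hg₃ ▸ h₄₀.symm), Or.inl h₂₃⟩
  · exact frameIndex_eq_one_iff.2 ⟨Or.inl h₄₀.symm, Or.inr (hg₄ ▸ h₂₃)⟩
  · grind [frameIndex]

variable {t : V → Fin 3} {i j : ZMod 5}

theorem ncard_index_eq_one [Finite V] (hp : NicePentagon G p f) (h₃ : t (p 3) = 1)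
    (h₄ : t (p 4) = 1) :
    {v | v ∉ Set.range ![p 0, p 1, p 2] ∧ t v = 1}.ncard =
      {v | v ∉ Set.range p ∧ t v = 1}.ncard + 2 := by
  have h₃₄ : p 3 ≠ p 4 := hp.injective.ne (by decide)
  have hset : {v | v ∉ Set.range ![p 0, p 1, p 2] ∧ t v = 1} =
      insert (p 3) (insert (p 4) {v | v ∉ Set.range p ∧ t v = 1}) := by
    ext v
    simp only [Set.mem_ofPred_eq, hp.notMem_range_vecCons_iff, Set.mem_insert_iff]
    grind
  rw [hset, Set.ncard_insert_of_notMem (by simp [h₃₄]), Set.ncard_insert_of_notMem (by simp)]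

theorem ncard_index_eq_two [Finite V] (hp : NicePentagon G p f) (h₃ : t (p 3) = 1)
    (h₄ : t (p 4) = 1) (h : ∀ v ∉ Set.range p, t v ≠ 2) :
    {v | v ∉ Set.range ![p 0, p 1, p 2] ∧ t v = 2}.ncard = 0 := by
  refine (Set.ncard_eq_zero (Set.toFinite _)).2 (Set.eq_empty_iff_forall_notMem.2 fun v hv => ?_)
  simp only [Set.mem_ofPred_eq, hp.notMem_range_vecCons_iff] at hv
  grind

theorem eq_of_adj_of_forall_eq_zero_or_eq_two
    (h : ∀ v ∉ Set.range p, ∀ i, G.Adj (p i) v → i = 0 ∨ i = 2)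
    (hij : i = 3 ∧ j = 4 ∨ i = 4 ∧ j = 3) (h₁ : ¬ G.Adj (p 1) (p i)) (hd : G.Adj (p i) d) :
    d = p j ∨ d = p 0 ∨ d = p 2 := by
  by_cases hdp : d ∈ Set.range p
  · obtain ⟨k, rfl⟩ := hdp
    have key : ∀ i j k : ZMod 5, i = 3 ∧ j = 4 ∨ i = 4 ∧ j = 3 → k ≠ 1 → k ≠ i →
        k = j ∨ k = 0 ∨ k = 2 := by decide
    have hk := key i j k hij (by rintro rfl; exact h₁ hd.symm) (by rintro rfl; exact hd.ne rfl)
    exact hk.imp (congrArg p) (Or.imp (congrArg p) (congrArg p))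
  · rcases hij with ⟨rfl, -⟩ | ⟨rfl, -⟩ <;> exact absurd (h d hdp _ hd) (by decide)

variable [Fintype V]

theorem eq_mate_or_mem_range_of_adj (hp : NicePentagon G p f) (hG : IsExceptional G)
    (hc : c ∉ Set.range p) (hcd : G.Adj c d) : d = f c ∨ ∃ i, p i = d :=
  or_iff_not_imp_right.2 fun hd => hp.eq_mate_of_adj hG hc hd hcd

theorem mem𝒢₃ (hp : NicePentagon G p f) (hG : IsExceptional G)
    (h : ∀ v ∉ Set.range p, ∀ i, G.Adj (p i) v → i = 0) : Mem𝒢₃ G := by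
  have h₀ (v) (hv : v ∉ Set.range p) : G.Adj (p 0) v := by
    obtain ⟨i, hi⟩ := hp.exists_adj hG hv
    exact h v hv i hi ▸ hi
  have h₂ (v) (hv : v ∉ Set.range p) : ¬ G.Adj (p 2) v := fun hv₂ =>
    absurd (h v hv 2 hv₂) (by decide)
  obtain ⟨g, t, hgt, ⟨-, ht₃⟩, ⟨-, ht₄⟩, hf⟩ := hp.exists_isA₂Frame fun v hv => Or.inl (h₀ v hv)
  have ht (v) (hv : v ∉ Set.range p) : t v = 0 := by
    rw [(hf v hv).2]
    exact frameIndex_eq_zero_iff.2 ⟨h₂ v hv, h₂ _ (hp.isPairing v hv).1⟩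
  refine hgt.mem𝒢₃ (Nat.card_eq_fintype_card (α := V) ▸ hG.card) ?_ ?_ ?_
  · have hset : {v | v ∉ Set.range p ∧ t v = 1} = ∅ :=
      Set.eq_empty_of_forall_notMem fun v hv => absurd hv.2 (by simp [ht v hv.1])
    rw [hp.ncard_index_eq_one ht₃ ht₄, hset, Set.ncard_empty]
  · exact hp.ncard_index_eq_two ht₃ ht₄ (by grind)
  · refine hp.forall_notMem_range_vecCons.2 ⟨by grind, by grind, fun v hv _ z hvz => ?_⟩
    rw [(hf v hv).1]
    refine (hp.eq_mate_or_mem_range_of_adj hG hv hvz).imp_right ?_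
    rintro ⟨i, rfl⟩
    exact h v hv i hvz.symm ▸ rfl

theorem eq_zero_of_adj_of_adj_two_of_adj_three (hp : NicePentagon G p f) (hG : IsExceptional G)
    (hc : c ∉ Set.range p) (hc₂ : G.Adj (p 2) c) (hc₃ : G.Adj (p 3) c) (hd : d ∉ Set.range p)
    (hdc : d ≠ c) (hi : G.Adj (p i) d) : i = 0 := by
  have key : ∀ i : ZMod 5, ¬ (i = 2 + 1 ∨ 2 = i + 1) → ¬ (i = 3 + 1 ∨ 3 = i + 1) → i = 0 := by
    decide
  exact key i (fun h => hp.not_adj_of_consecutive hG hc hd hdc hc₂ h hi)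
    fun h => hp.not_adj_of_consecutive hG hc hd hdc hc₃ h hi

theorem adj_two_iff_of_adj_two_of_adj_three (hp : NicePentagon G p f) (hG : IsExceptional G)
    (hc : c ∉ Set.range p) (hc₂ : G.Adj (p 2) c) (hc₃ : G.Adj (p 3) c) (hd : d ∉ Set.range p) :
    G.Adj (p 2) d ↔ d = c := by
  refine ⟨fun hd₂ => by_contra fun hdc => ?_, fun h => h ▸ hc₂⟩
  exact absurd (hp.eq_zero_of_adj_of_adj_two_of_adj_three hG hc hc₂ hc₃ hd hdc hd₂) (by decide)

theorem exists_isA₂Frame_of_adj_two_of_adj_three (hp : NicePentagon G p f) (hG : IsExceptional G)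
    (hc : c ∉ Set.range p) (hc₂ : G.Adj (p 2) c) (hc₃ : G.Adj (p 3) c) :
    ∃ g t, IsA₂Frame G ![p 0, p 1, p 2] g t ∧ (g (p 3) = p 4 ∧ t (p 3) = 1) ∧
      (g (p 4) = p 3 ∧ t (p 4) = 1) ∧
      ∀ v ∉ Set.range p, g v = f v ∧ (t v = 1 ↔ v = c ∨ v = f c) ∧ t v ≠ 2 := by
  have h₂ {v} := hp.adj_two_iff_of_adj_two_of_adj_three hG hc hc₂ hc₃ (d := v)
  have h₀ {v} (hv : v ∉ Set.range p) (hvc : v ≠ c) : G.Adj (p 0) v := by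
    obtain ⟨i, hi⟩ := hp.exists_adj hG hv
    exact hp.eq_zero_of_adj_of_adj_two_of_adj_three hG hc hc₂ hc₃ hv hvc hi ▸ hi
  obtain ⟨g, t, hgt, hg₃, hg₄, hf⟩ := hp.exists_isA₂Frame fun v hv => by
    rw [h₂ hv]
    exact (em (v = c)).symm.imp_left (h₀ hv)
  refine ⟨g, t, hgt, hg₃, hg₄, fun v hv => ⟨(hf v hv).1, ?_⟩⟩
  obtain ⟨hfv, hvfv, hffv⟩ := hp.isPairing v hv
  obtain ⟨hfc, -, hffc⟩ := hp.isPairing c hc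
  have h₀v : G.Adj (p 0) v ∨ G.Adj (p 0) (f v) := by grind [hvfv.ne]
  rw [(hf v hv).2, frameIndex_eq_one_iff, Ne, frameIndex_eq_two_iff]
  refine ⟨((and_iff_right h₀v).trans (or_congr (h₂ hv) (h₂ hfv))).trans ?_, fun h => ?_⟩
  · grind
  · exact h₀v.elim h.1.1 h.1.2

theorem eq_or_eq_of_adj_four (hp : NicePentagon G p f) (hG : IsExceptional G)
    (hc : c ∉ Set.range p) (hc₂ : G.Adj (p 2) c) (hc₃ : G.Adj (p 3) c) (hc₀ : G.Adj (p 0) (f c))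
    (hd : G.Adj (p 4) d) : d = p 3 ∨ d = p 0 := by
  obtain ⟨hfc, hcfc, -⟩ := hp.isPairing c hc
  obtain ⟨-, h₁₄, h₂₄⟩ := hp.not_adj_of_adj_two_of_adj_three hG hc hc₂ hc₃ hc₀
  by_cases hdp : d ∈ Set.range p
  · obtain ⟨i, rfl⟩ := hdp
    fin_cases i
    exacts [Or.inr rfl, absurd hd.symm h₁₄, absurd hd.symm h₂₄, Or.inl rfl, absurd rfl hd.ne]
  · obtain rfl : d = c := by
      by_contra hdc
      have := hp.eq_zero_of_adj_of_adj_two_of_adj_three hG hc hc₂ hc₃ hdp hdc hd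
      exact absurd this (by decide)
    exact absurd hd (hp.not_adj_of_consecutive hG hfc hc hcfc.ne hc₀ (by decide))

/-- The vertices `c` and `f c` play the roles of `v_{3,2}` and `v_{1,2}`. -/
theorem mem𝒢₄ (hp : NicePentagon G p f) (hG : IsExceptional G) (hc : c ∉ Set.range p)
    (hc₂ : G.Adj (p 2) c) (hc₃ : G.Adj (p 3) c) (hc₀ : G.Adj (p 0) (f c)) : Mem𝒢₄ G := by
  obtain ⟨hfc, hcfc, hffc⟩ := hp.isPairing c hc
  obtain ⟨h₁₃, -, h₂₄⟩ := hp.not_adj_of_adj_two_of_adj_three hG hc hc₂ hc₃ hc₀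
  have hout {v i} := hp.eq_zero_of_adj_of_adj_two_of_adj_three hG hc hc₂ hc₃ (d := v) (i := i)
  have h₂ {v} := hp.adj_two_iff_of_adj_two_of_adj_three hG hc hc₂ hc₃ (d := v)
  obtain ⟨g, t, hgt, ⟨hg₃, ht₃⟩, ⟨hg₄, ht₄⟩, hf⟩ :=
    hp.exists_isA₂Frame_of_adj_two_of_adj_three hG hc hc₂ hc₃
  refine hgt.mem𝒢₄ (Nat.card_eq_fintype_card (α := V) ▸ hG.card) ?_ ?_ ?_ ?_ ?_
  · have hset : {v | v ∉ Set.range p ∧ t v = 1} = {c, f c} := by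
      ext v
      simp only [Set.mem_ofPred_eq, Set.mem_insert_iff, Set.mem_singleton_iff]
      grind
    rw [hp.ncard_index_eq_one ht₃ ht₄, hset, Set.ncard_pair hcfc.ne]
  · exact hp.ncard_index_eq_two ht₃ ht₄ fun v hv => (hf v hv).2.2
  · refine hp.forall_notMem_range_vecCons.2 ⟨?_, ?_, fun v hv hvt z hvz => ?_⟩
    · rw [ht₃, hg₃]
      exact fun h => absurd h (by simp [h₂₄])
    · rw [hg₄]
      exact fun _ z => hp.eq_or_eq_of_adj_four hG hc hc₂ hc₃ hc₀
    · obtain ⟨hgv, ht₁, -⟩ := hf v hv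
      have hvc : v ≠ c := by
        rintro rfl
        rw [ht₁.2 (Or.inl rfl), hgv] at hvt
        exact hcfc.ne' ((h₂ hfc).1 (hvt.resolve_left (by decide)).2)
      rw [hgv]
      refine (hp.eq_mate_or_mem_range_of_adj hG hv hvz).imp_right ?_
      rintro ⟨i, rfl⟩
      exact hout hv hvc hvz.symm ▸ rfl
  · refine hp.forall_notMem_range_vecCons.2 ⟨?_, ?_, ?_⟩
    · exact fun _ _ h => h₁₃ h.symm
    · exact fun _ h _ => h₂₄ h
    · rintro v hv - hv₂ hv₁
      obtain rfl := (h₂ hv).1 hv₂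
      exact hp.not_adj_of_consecutive hG hfc hc hcfc.ne hc₀ (j := 1) (by decide) hv₁.symm
  · have hset : {v | v ∉ Set.range ![p 0, p 1, p 2] ∧ t v = 1 ∧ G.Adj (p 2) v} ⊆ {p 3, c} := by
      rintro v ⟨hv, -, hv₂⟩
      rw [hp.notMem_range_vecCons_iff] at hv
      rcases hv with rfl | rfl | hv
      exacts [Or.inl rfl, absurd hv₂ h₂₄, Or.inr ((h₂ hv).1 hv₂)]
    exact (Set.pairwise_pair.2 fun _ => ⟨hc₃, hc₃.symm⟩).mono hset

theorem not_adj_of_forall_eq_zero_or_eq_two (hp : NicePentagon G p f) (hG : IsExceptional G)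
    (h : ∀ v ∉ Set.range p, ∀ i, G.Adj (p i) v → i = 0 ∨ i = 2) (hc : c ∉ Set.range p)
    (hc₀ : G.Adj (p 0) c) (hd : d ∉ Set.range p) (hd₂ : G.Adj (p 2) d) :
    ¬ G.Adj (p 1) (p 3) ∧ ¬ G.Adj (p 1) (p 4) := by
  rcases eq_or_ne d c with rfl | hdc
  · obtain ⟨hfd, hdfd, -⟩ := hp.isPairing d hd
    obtain ⟨i, hi⟩ := hp.exists_adj hG hfd
    rcases h _ hfd i hi with rfl | rfl
    · exact hp.not_adj_of_adj_zero_of_adj_two hG hfd hd hdfd.ne hi hd₂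
    · exact hp.not_adj_of_adj_zero_of_adj_two hG hd hfd hdfd.ne' hc₀ hi
  · exact hp.not_adj_of_adj_zero_of_adj_two hG hc hd hdc hc₀ hd₂

theorem mem𝒢₂ (hp : NicePentagon G p f) (hG : IsExceptional G)
    (h : ∀ v ∉ Set.range p, ∀ i, G.Adj (p i) v → i = 0 ∨ i = 2) (hc : c ∉ Set.range p)
    (hc₀ : G.Adj (p 0) c) (hd : d ∉ Set.range p) (hd₂ : G.Adj (p 2) d) : Mem𝒢₂ G := by
  obtain ⟨h₁₃, h₁₄⟩ := hp.not_adj_of_forall_eq_zero_or_eq_two hG h hc hc₀ hd hd₂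
  obtain ⟨g, t, hgt, ⟨hg₃, ht₃⟩, ⟨hg₄, ht₄⟩, hf⟩ := hp.exists_isA₂Frame fun v hv => by
    obtain ⟨i, hi⟩ := hp.exists_adj hG hv
    rcases h v hv i hi with rfl | rfl
    exacts [Or.inl hi, Or.inr hi]
  have ht₀ {v} (hv : v ∉ Set.range p) (hv₂ : G.Adj (p 2) v) : t v ≠ 0 := by
    rw [(hf v hv).2]
    exact fun h => (frameIndex_eq_zero_iff.1 h).1 hv₂
  have ht₂ {v} (hv : v ∉ Set.range p) (hv₀ : G.Adj (p 0) v) : t v ≠ 2 := by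
    rw [(hf v hv).2]
    exact fun h => (frameIndex_eq_two_iff.1 h).1.1 hv₀
  have hp₃ := hp.notMem_range_vecCons_iff.2 (Or.inl (Eq.refl (p 3)))
  refine hgt.mem𝒢₂ (Nat.card_eq_fintype_card (α := V) ▸ hG.card) ⟨p 3, hp₃, ht₃⟩ ?_ ?_
  · rw [hp.ncard_index_eq_one ht₃ ht₄]
    by_cases h₁ : ∃ v ∉ Set.range p, t v = 1
    · have := (Set.ncard_pos (Set.toFinite {v | v ∉ Set.range p ∧ t v = 1})).2 h₁
      exact Or.inr (by lia)
    · push Not at h₁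
      have hmem {v} (hv : v ∉ Set.range p) := hp.notMem_range_vecCons_iff.2 (Or.inr (Or.inr hv))
      exact Or.inl ⟨⟨c, hmem hc, by grind⟩, d, hmem hd, by grind⟩
  · refine hp.forall_notMem_range_vecCons.2 ⟨fun z hz => ?_, fun z hz => ?_, fun v hv z hvz => ?_⟩
    · rw [hg₃, ht₃]
      simpa using eq_of_adj_of_forall_eq_zero_or_eq_two h (by simp) h₁₃ hz
    · rw [hg₄, ht₄]
      simpa using eq_of_adj_of_forall_eq_zero_or_eq_two h (by simp) h₁₄ hz
    · rw [(hf v hv).1]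
      refine (hp.eq_mate_or_mem_range_of_adj hG hv hvz).imp_right ?_
      rintro ⟨i, rfl⟩
      rcases h v hv i hvz.symm with rfl | rfl
      · exact Or.inl ⟨rfl, ht₂ hv hvz.symm⟩
      · exact Or.inr ⟨rfl, ht₀ hv hvz.symm⟩

theorem not_adj_add_one_of_forall (hp : NicePentagon G p f) (hG : IsExceptional G)
    (h : ∀ c ∉ Set.range p, ∀ i, G.Adj (p (2 + i)) c → G.Adj (p (3 + i)) c → ¬ G.Adj (p i) (f c))
    (hc : c ∉ Set.range p) (hd : d ∉ Set.range p) (hi : G.Adj (p i) c) :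
    ¬ G.Adj (p (i + 1)) d := by
  rcases eq_or_ne d c with rfl | hdc
  · intro hi₁
    obtain ⟨hfc, hcfc, -⟩ := hp.isPairing d hc
    obtain ⟨j, hj⟩ := hp.exists_adj_mate hG hc hi
    have key : ∀ i j : ZMod 5, ¬ (i = j + 1 ∨ j = i + 1) → ¬ (i + 1 = j + 1 ∨ j = i + 1 + 1) →
        i = 2 + j ∧ i + 1 = 3 + j := by decide
    obtain ⟨h₂, h₃⟩ := key i j
      (fun hij => hp.not_adj_of_consecutive hG hfc hc hcfc.ne hj hij hi)
      fun hij => hp.not_adj_of_consecutive hG hfc hc hcfc.ne hj hij hi₁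
    exact h d hc j (h₂ ▸ hi) (h₃ ▸ hi₁) hj
  · exact hp.not_adj_succ hG hc hd hdc hi

theorem mem𝒢₂_of_ne (hp : NicePentagon G p f) (hG : IsExceptional G)
    (h : ∀ c ∉ Set.range p, ∀ d ∉ Set.range p, ∀ i, G.Adj (p i) c → ¬ G.Adj (p (i + 1)) d)
    (hc : c ∉ Set.range p) (hi : G.Adj (p i) c) (hd : d ∉ Set.range p) (hj : G.Adj (p j) d)
    (hij : j ≠ i) : Mem𝒢₂ G := by
  wlog hji : j = 2 + i generalizing i j c d
  · have key : ∀ i j : ZMod 5, j ≠ i → j ≠ 2 + i → j ≠ i + 1 → i ≠ j + 1 → i = 2 + j := by decide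
    exact this hd hj hc hi hij.symm (key i j hij hji (by rintro rfl; exact h c hc d hd i hi hj)
      (by rintro rfl; exact h d hd c hc j hj hi))
  subst hji
  have hk (v) (hv : v ∉ Set.range p) (k) (hkv : G.Adj (p (k + i)) v) : k = 0 ∨ k = 2 := by
    have key : ∀ i k : ZMod 5, k + i ≠ i + 1 → i ≠ k + i + 1 → k + i ≠ 2 + i + 1 →
        2 + i ≠ k + i + 1 → k = 0 ∨ k = 2 := by decide
    exact key i k (fun e => h c hc v hv i hi (e ▸ hkv)) (fun e => h v hv c hc _ hkv (e ▸ hi))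
      (fun e => h d hd v hv _ hj (e ▸ hkv)) fun e => h v hv d hd _ hkv (e ▸ hj)
  exact (hp.rotate i).mem𝒢₂ hG (by simpa only [range_rotate] using hk) (by rwa [range_rotate])
    (c := c) (by simpa using hi) (by rwa [range_rotate]) hj

theorem mem_families (hp : NicePentagon G p f) (hG : IsExceptional G) :
    Mem𝒢₂ G ∨ Mem𝒢₃ G ∨ Mem𝒢₄ G := by
  by_cases h₄ : ∀ c ∉ Set.range p, ∀ i, G.Adj (p (2 + i)) c → G.Adj (p (3 + i)) c →
      ¬ G.Adj (p i) (f c)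
  · have hcons (c) (hc : c ∉ Set.range p) (d) (hd : d ∉ Set.range p) (i) :=
      hp.not_adj_add_one_of_forall hG h₄ hc hd (i := i)
    by_cases h₃ : ∃ k, ∀ v ∉ Set.range p, ∀ i, G.Adj (p i) v → i = k
    · obtain ⟨k, hk⟩ := h₃
      refine Or.inr (Or.inl ((hp.rotate k).mem𝒢₃ hG fun v hv i hi => ?_))
      rw [range_rotate] at hv
      simpa using hk v hv _ hi
    · push Not at h₃
      obtain ⟨c, hc, i, hi, -⟩ := h₃ 0
      obtain ⟨d, hd, j, hj, hij⟩ := h₃ i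
      exact Or.inl (hp.mem𝒢₂_of_ne hG hcons hc hi hd hj hij)
  · push Not at h₄
    obtain ⟨c, hc, i, hi₂, hi₃, hi₀⟩ := h₄
    exact Or.inr (Or.inr ((hp.rotate i).mem𝒢₄ hG (by rwa [range_rotate]) hi₂ hi₃
      (by simpa using hi₀)))

end NicePentagon

end Classification

theorem proposition4p4 {V : Type*} [Fintype V] (G : SimpleGraph V)
    (hG : Hypomatchable G) (hcard : 9 ≤ Fintype.card V)
    (hfactor : ¬ HasPathFactor {2, 9} G) :
    HypoFamilies.Mem𝒢₁ G ∨ HypoFamilies.Mem𝒢₂ G ∨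
      HypoFamilies.Mem𝒢₃ G ∨ HypoFamilies.Mem𝒢₄ G := by
  have hE : IsExceptional G := ⟨hG, hcard, hfactor⟩
  by_cases h₅ : ∃ p f, NicePentagon G p f
  · obtain ⟨p, f, hp⟩ := h₅
    exact Or.inr (hp.mem_families hE)
  · exact Or.inl (hE.mem𝒢₁ h₅)
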